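/- \textbf{Cluster structure of the generalized negative binomial process.} Let $S$ be a measurable space that is countably separated (for instance a Polish space with its Borel sets), let $G_0$ be a finite, non-zero measure on $S$ without atoms, $\gamma_0:=G_0(S)$, let $a<1$, $0<p<1$ and $c:=(1-p)/p$. Expressions of the form $(x^a-y^a)/a$ are read at $a=0$ as their limit $\ln(x/y)$. \emph{The model.} For $\gamma\ge 0$, $\mathrm{gGamma}(\gamma,a,1/c)$ is the law on $[0,\infty)$ with Laplace transform $s\mapsto\exp(-\frac{\gamma}{a}[(c+s)^a-c^a])$, $s\ge 0$. Let $G=\sum_k r_k\delta_{\omega_k}$ ($r_k\ge0$, finitely or countably many atoms, a.s. distinct locations) be a generalized gamma process $\mathrm{gGaP}(G_0,a,c)$, i.e. an a.s. finite random measure whose values on disjoint measurable sets are independent, with $G(A)\sim\mathrm{gGamma}(G_0(A),a,1/c)$. Given $G$, let $m\sim\mathrm{Pois}(G(S))$, and given $G$ and $m$ let $z_1,\dots,z_m$ be i.i.d. with law $\sum_k \frac{r_k}{G(S)}\delta_k$ (nothing is drawn if $m=0$). The ties $z_i=z_j$ define a random partition $\Pi_m$ of $\{1,\dots,m\}$;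 its blocks are the clusters. For a partition $\pi$ of $\{1,\dots,n\}$ with $l$ blocks of sizes $n_1,\dots,n_l$ write $f(\pi,n):=P(m=n,\ \Pi_m=\pi)$. Put $$\lambda:=\gamma_0\frac{1-(1-p)^a}{a p^a},\qquad S_a(n,l):=\frac{n!}{l!}\sum_{\substack{n_1+\dots+n_l=n\\ n_k\ge 1}}\ \prod_{k=1}^l\frac{\Gamma(n_k-a)}{n_k!\,\Gamma(1-a)},$$ and let $\mathrm{TNB}(a,p)$ be the law on $\{1,2,\dots\}$ with mass function $\frac{\Gamma(u-a)}{u!\,\Gamma(-a)}\frac{p^u(1-p)^{-a}}{1-(1-p)^{-a}}$ (for $a=0$: $\frac{-1}{\ln(1-p)}\frac{p^u}{u}$). Let $\mathrm{gNB}(\gamma_0,a,p)$ be the law of $m\sim\mathrm{Pois}(\Lambda)$ with $\Lambda\sim\mathrm{gGamma}(\gamma_0,a,p/(1-p))$. \emph{Then:} (1) (ECPF) For every $n\ge 0$ and every partition $\pi$ of $\{1,\dots,n\}$, $$f(\pi,n)=\frac1{n!}\,e^{-\lambda}\,\gamma_0^{l}\,p^{\,n-al}\prod_{k=1}^l\frac{\Gamma(n_k-a)}{\Gamma(1-a)}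 .$$ (2) (EPPF) For every such $n$ and $\pi$, $$P(\Pi_m=\pi\mid m=n)=\frac{\gamma_0^{l}\,p^{-al}}{\sum_{j=0}^n\gamma_0^{j}p^{-aj}S_a(n,j)}\prod_{k=1}^l\frac{\Gamma(n_k-a)}{\Gamma(1-a)},$$ and if $a\ne 0$ the denominator is also the sum of the convergent series $$e^{\gamma_0/(ap^a)}\sum_{k=0}^\infty\frac1{k!}\Big(-\frac{\gamma_0}{ap^a}\Big)^k\frac{\Gamma(n-ak)}{\Gamma(-ak)},$$ where $\Gamma(n-ak)/\Gamma(-ak)$ denotes the rising factorial $\prod_{j=0}^{n-1}(j-ak)$. (3) (Cluster structure) For positive integers $n_1,\dots,n_l$ let $f(\{n_k\}_{1,l},n)$ be the probability that $m=n$, that there are exactly $l$ clusters, and that they have sizes $n_1,\dots,n_l$ when they are labelled $1,\dots,l$ uniformly at random. If $\sum_k n_k=n$, then for every partition $\pi$ of $\{1,\dots,n\}$ into blocks of these sizes, $$f(\{n_k\}_{1,l},n)=\frac1{l!}\,\frac{n!}{\prod_{k} n_k!}\,f(\pi,n)=\mathrm{Pois}(l;\lambda)\prod_{k=1}^l\mathrm{TNB}(n_k;a,p),$$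 and $f(\{n_k\}_{1,l},n)=0$ if $\sum_k n_k\ne n$. Equivalently, $\mathrm{TNB}(a,p)$ is a probability measure and the random multiset of cluster sizes has the law of $\{u_1,\dots,u_N\}$ with $N\sim\mathrm{Pois}(\lambda)$ and, given $N$, $u_1,\dots,u_N$ i.i.d. $\mathrm{TNB}(a,p)$. In particular the number of clusters is $\mathrm{Pois}(\lambda)$. (4) $m\sim\mathrm{gNB}(\gamma_0,a,p)$, with $$\mathbb E[t^m]=\exp\Big(-\gamma_0\frac{(1-pt)^a-(1-p)^a}{ap^a}\Big)\ (|t|\le 1),\qquad P(m=n)=\frac{p^n}{n!}e^{-\lambda}\sum_{l=0}^n\gamma_0^lp^{-al}S_a(n,l)\ (n\ge 0).$$ -/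

import Mathlib

open MeasureTheory ProbabilityTheory
open scoped NNReal ENNReal

/-! ### Generalized gamma process -/

/-- The Laplace exponent of the generalized gamma law with unit mass, discount `a` and rate `c`:
`((c + s)^a - c^a) / a`, read as its limit `log ((c + s) / c)` when `a = 0`. -/
noncomputable def genGammaExponent (a c s : ℝ) : ℝ :=
  if a = 0 then Real.log ((c + s) / c) else ((c + s) ^ a - c ^ a) / a

/-- `μ` is the generalized gamma distribution `gGamma(γ, a, θ)` (mass `γ`, discount `a`,
scale `θ = 1 / c`): the law on `[0, ∞)` with Laplace transform
`s ↦ exp (-γ ((c + s)^a - c^a) / a)`. -/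
structure IsGenGamma (μ : Measure ℝ) (γ a θ : ℝ) : Prop where
  isProbabilityMeasure : IsProbabilityMeasure μ
  nonneg : ∀ᵐ x ∂μ, 0 ≤ x
  laplace : ∀ s : ℝ, 0 ≤ s →
    ∫ x, Real.exp (-(s * x)) ∂μ = Real.exp (-(γ * genGammaExponent a θ⁻¹ s))

/-- `G` is a generalized gamma process `gGaP(G₀, a, c)` on `S`: an a.s. finite random measure that
assigns independent masses `G(A) ∼ gGamma(G₀(A), a, 1 / c)` to disjoint measurable sets. -/
structure IsGenGammaProcess {Ω S : Type*} [MeasurableSpace Ω] [MeasurableSpace S]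
    (P : Measure Ω) (G : Ω → Measure S) (G₀ : Measure S) (a c : ℝ) : Prop where
  measurable : Measurable G
  finite : ∀ᵐ ω ∂P, G ω Set.univ < ∞
  indep : ∀ (n : ℕ) (A : Fin n → Set S), (∀ i, MeasurableSet (A i)) →
    Pairwise (fun i j => Disjoint (A i) (A j)) → iIndepFun (fun i ω => G ω (A i)) P
  law : ∀ A : Set S, MeasurableSet A →
    IsGenGamma (P.map fun ω => (G ω).real A) (G₀.real A) a c⁻¹

/-! ### Count-mixture model -/

/-- The random measure `∑ₖ wₖ δ_{xₖ}` with weights `wₖ ≥ 0` and atom locations `xₖ`. A finite number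
`K` of atoms is the case `wₖ = 0` for `k ≥ K`. -/
noncomputable def atomicMeasure {Ω S : Type*} [MeasurableSpace S]
    (w : ℕ → Ω → ℝ≥0) (x : ℕ → Ω → S) (ω : Ω) : Measure S :=
  Measure.sum fun k => (w k ω : ℝ≥0∞) • Measure.dirac (x k ω)

/-- The σ-algebra generated by the weights and the locations of all atoms. -/
abbrev atomSigma {Ω S : Type*} [MeasurableSpace S]
    (w : ℕ → Ω → ℝ≥0) (x : ℕ → Ω → S) : MeasurableSpace Ω :=
  ⨆ k, (MeasurableSpace.comap (w k) inferInstance ⊔ MeasurableSpace.comap (x k) inferInstance)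

/-- The count-mixture model driven by `G = ∑ₖ wₖ δ_{xₖ}`, with distinct atoms: given `G`, the sample
size is `m ∼ Pois(G(S))`, and given `G` and `m` the atom indices `z₀, …, z_{m-1}` of the data points
are independent with law `∑ₖ (wₖ / G(S)) δₖ`. The values `zᵢ` with `i ≥ m` play no role. -/
structure IsCountMixture {Ω S : Type*} [MeasurableSpace Ω] [MeasurableSpace S]
    (P : Measure Ω) (w : ℕ → Ω → ℝ≥0) (x : ℕ → Ω → S) (m : Ω → ℕ) (z : ℕ → Ω → ℕ) : Prop where
  measurable_weight : ∀ k, Measurable (w k)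
  measurable_loc : ∀ k, Measurable (x k)
  measurable_size : Measurable m
  measurable_index : ∀ i, Measurable (z i)
  distinct : ∀ᵐ ω ∂P, ∀ j k, w j ω ≠ 0 → w k ω ≠ 0 → x j ω = x k ω → j = k
  condLaw : ∀ (n : ℕ) (k : Fin n → ℕ),
    P⟦{ω | m ω = n ∧ ∀ i : Fin n, z i ω = k i} | atomSigma w x⟧ =ᵐ[P] fun ω =>
      (Real.exp (-(atomicMeasure w x ω).real Set.univ) *
          (atomicMeasure w x ω).real Set.univ ^ n / (n.factorial : ℝ)) *
        ∏ i, ((w (k i) ω : ℝ) / (atomicMeasure w x ω).real Set.univ)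

/-! ### The random partition and the clusters -/

/-- The partition of `{0, …, n-1}` given by the ties `z i = z j`. -/
def tiePartition {n : ℕ} {β : Type*} [DecidableEq β] (z : Fin n → β) :
    Finpartition (Finset.univ : Finset (Fin n)) :=
  letI : DecidableRel (Setoid.ker z).r := fun i j => decEq (z i) (z j)
  Finpartition.ofSetoid (Setoid.ker z)

/-- The event that the sample size is `n` and the partition of the sample is `π`. -/
def clusterEvent {Ω : Type*} (m : Ω → ℕ) (z : ℕ → Ω → ℕ) {n : ℕ}
    (π : Finpartition (Finset.univ : Finset (Fin n))) : Set Ω :=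
  {ω | m ω = n ∧ tiePartition (fun i : Fin n => z i ω) = π}

/-- The number of clusters in the sample. -/
def numClusters {Ω : Type*} (m : Ω → ℕ) (z : ℕ → Ω → ℕ) (ω : Ω) : ℕ :=
  (tiePartition (fun i : Fin (m ω) => z i ω)).parts.card

/-- The multiset of the sizes of the clusters in the sample. -/
def clusterSizes {Ω : Type*} (m : Ω → ℕ) (z : ℕ → Ω → ℕ) (ω : Ω) : Multiset ℕ :=
  (tiePartition (fun i : Fin (m ω) => z i ω)).parts.val.map Finset.card

/-- The labellings of `n` data points by `l` labels in which label `k` is used `u k` times. -/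
def labellings (n l : ℕ) (u : Fin l → ℕ) : Finset (Fin n → Fin l) :=
  Finset.univ.filter fun c => ∀ k, (Finset.univ.filter fun i => c i = k).card = u k

/-- The probability `f({n₁, …, n_l}, n)` that the sample has size `n` and `l` clusters which, when
labelled `1, …, l` uniformly at random, have sizes `u 1, …, u l`. -/
noncomputable def sizesProb {Ω : Type*} [MeasurableSpace Ω] (P : Measure Ω)
    (m : Ω → ℕ) (z : ℕ → Ω → ℕ) (n l : ℕ) (u : Fin l → ℕ) : ℝ :=
  (1 / (l.factorial : ℝ)) *
    ∑ c ∈ labellings n l u, P.real (clusterEvent m z (tiePartition c))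

/-! ### Distributions on the natural numbers -/

/-- `(1 - (1 - p)^a) / (a p^a)`, read as its limit `-log (1 - p)` when `a = 0`. -/
noncomputable def clusterRate (a p : ℝ) : ℝ :=
  if a = 0 then -Real.log (1 - p) else (1 - (1 - p) ^ a) / (a * p ^ a)

/-- The probability mass function of the truncated negative binomial law `TNB(a, p)` on
`{1, 2, …}`; for `a = 0` it is the logarithmic law. -/
noncomputable def tnbPMFReal (a p : ℝ) (u : ℕ) : ℝ :=
  if u = 0 then 0
  else if a = 0 then -1 / Real.log (1 - p) * (p ^ u / (u : ℝ))
  else Real.Gamma (u - a) / ((u.factorial : ℝ) * Real.Gamma (-a)) *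
    (p ^ u * (1 - p) ^ (-a) / (1 - (1 - p) ^ (-a)))

/-- The truncated negative binomial law `TNB(a, p)`. -/
noncomputable def tnbMeasure (a p : ℝ) : Measure ℕ :=
  Measure.sum fun u => ENNReal.ofReal (tnbPMFReal a p u) • Measure.dirac u

/-- `μ` is the generalized negative binomial law `gNB(γ, a, p)`: the law of `m ∼ Pois(λ)` with
`λ ∼ gGamma(γ, a, p / (1 - p))`. -/
def IsGenNegBinomial (μ : Measure ℕ) (γ a p : ℝ) : Prop :=
  ∃ ν : Measure ℝ, IsGenGamma ν γ a (p / (1 - p)) ∧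
    μ = ν.bind fun t => poissonMeasure t.toNNReal

/-- `((1 - p t)^a - (1 - p)^a) / (a p^a)`, read as its limit `log ((1 - p t) / (1 - p))` when
`a = 0`. -/
noncomputable def gnbExponent (a p t : ℝ) : ℝ :=
  if a = 0 then Real.log ((1 - p * t) / (1 - p))
  else ((1 - p * t) ^ a - (1 - p) ^ a) / (a * p ^ a)

instance instMeasurableSpaceMultisetNat : MeasurableSpace (Multiset ℕ) := ⊤

/-- The law of the multiset `{u₁, …, u_N}` where `N ∼ Pois(r)` and, given `N`, the `uₖ` are
independent with law `τ`. -/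
noncomputable def compoundSizesLaw (r : ℝ≥0) (τ : Measure ℕ) : Measure (Multiset ℕ) :=
  (poissonMeasure r).bind fun l =>
    (Measure.pi fun _ : Fin l => τ).map fun u => (Finset.univ : Finset (Fin l)).val.map u

/-! ### Generalized Stirling numbers -/

/-- The generalized Stirling number of the first kind
`S_a(m, l) = (m! / l!) ∑ ∏ₖ Γ(nₖ - a) / (nₖ! Γ(1 - a))`, the sum being over all `l`-tuples of
positive integers with `n₁ + ⋯ + n_l = m`. -/
noncomputable def genStirling (a : ℝ) (m l : ℕ) : ℝ :=
  (m.factorial : ℝ) / (l.factorial : ℝ) *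
    ∑ n ∈ (Finset.piAntidiag (Finset.univ : Finset (Fin l)) m).filter (fun n => ∀ k, 0 < n k),
      ∏ k, Real.Gamma ((n k : ℝ) - a) / (((n k).factorial : ℝ) * Real.Gamma (1 - a))

/-- `∑_{l=0}^m γ^l p^{-al} S_a(m, l)`. -/
noncomputable def eppfNormalizer (γ a p : ℝ) (m : ℕ) : ℝ :=
  ∑ l ∈ Finset.range (m + 1), γ ^ l * p ^ (-(a * l)) * genStirling a m l

/-!
Split `S` into finitely many cells, fine enough for `n` sampled atoms lying in distinct clusters to
lie in distinct cells. The masses of the cells are independent, so the probability of a partition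
becomes a sum, over assignments of its blocks to cells, of products of exponentially tilted moments
of generalized gamma variables. A cell of base mass `γ` carrying `n` sampled points contributes
`γ` times the weight of a single cluster of size `n`, up to `O(γ²)`. As `G₀` has no atoms, the cells
can be refined so that the error terms and the assignments that are not injective disappear in the
limit, which leaves a product over the blocks.

That product is multiplicative in the block sizes, and labelling the blocks at random turns it into
a Poisson probability times a product of truncated negative binomial probabilities.
-/

/-! ### Partitions given by ties, and labellings -/

section Ties

open Finset

variable {n l : ℕ} {β : Type*} [DecidableEq β]

lemma mem_part_tiePartition (z : Fin n → β) (i j : Fin n) :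
    i ∈ (tiePartition z).part j ↔ z j = z i :=
  letI : DecidableRel (Setoid.ker z).r := fun i j => decEq (z i) (z j)
  Finpartition.mem_part_ofSetoid_iff_rel (s := Setoid.ker z)

lemma part_tiePartition_eq_iff (z : Fin n → β) (i j : Fin n) :
    (tiePartition z).part i = (tiePartition z).part j ↔ z i = z j := by
  rw [← Finpartition.mem_part_iff_part_eq_part _ (mem_univ _) (mem_univ _),
    mem_part_tiePartition, eq_comm]

lemma image_part_univ (π : Finpartition (univ : Finset (Fin n))) :
    univ.image π.part = π.parts := by
  ext B
  simp only [mem_image, mem_univ, true_and]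
  constructor
  · rintro ⟨i, rfl⟩
    exact π.part_mem.2 (mem_univ i)
  · intro hB
    obtain ⟨i, hi⟩ := π.nonempty_of_mem_parts hB
    exact ⟨i, π.part_eq_of_mem hB hi⟩

lemma tiePartition_eq_iff (z : Fin n → β) (π : Finpartition (univ : Finset (Fin n))) :
    tiePartition z = π ↔ ∀ i j, z i = z j ↔ π.part i = π.part j := by
  constructor
  · rintro rfl i j
    exact (part_tiePartition_eq_iff z i j).symm
  · intro h
    have part_eq : (tiePartition z).part = π.part := by
      ext j i
      rw [mem_part_tiePartition, h,
        Finpartition.mem_part_iff_part_eq_part _ (mem_univ _) (mem_univ _), eq_comm]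
    exact Finpartition.ext (by rw [← image_part_univ, part_eq, image_part_univ])

lemma tiePartition_congr {δ : Type*} [DecidableEq δ] {z : Fin n → β} {y : Fin n → δ}
    (h : ∀ i j, z i = z j ↔ y i = y j) : tiePartition z = tiePartition y := by
  rw [tiePartition_eq_iff]
  intro i j
  rw [part_tiePartition_eq_iff, h]

/-- The block of the partition `π` that contains `i`. -/
def blockOf (π : Finpartition (univ : Finset (Fin n))) (i : Fin n) : π.parts :=
  ⟨π.part i, π.part_mem.2 (mem_univ i)⟩

lemma blockOf_eq_blockOf_iff (π : Finpartition (univ : Finset (Fin n))) (i j : Fin n) :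
    blockOf π i = blockOf π j ↔ π.part i = π.part j :=
  Subtype.ext_iff

lemma blockOf_surjective (π : Finpartition (univ : Finset (Fin n))) :
    Function.Surjective (blockOf π) := by
  rintro ⟨B, hB⟩
  obtain ⟨i, hi⟩ := π.nonempty_of_mem_parts hB
  exact ⟨i, Subtype.ext (π.part_eq_of_mem hB hi)⟩

lemma filter_blockOf_eq (π : Finpartition (univ : Finset (Fin n))) (B : π.parts) :
    univ.filter (fun i => blockOf π i = B) = B.1 := by
  ext i
  rw [mem_filter_univ, ← π.part_eq_iff_mem B.2, Subtype.ext_iff, blockOf]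

lemma tiePartition_comp_blockOf (π : Finpartition (univ : Finset (Fin n))) (σ : π.parts ↪ β) :
    (tiePartition fun i => σ (blockOf π i)) = π := by
  rw [tiePartition_eq_iff]
  intro i j
  rw [σ.injective.eq_iff, blockOf_eq_blockOf_iff]

lemma exists_embedding_of_tiePartition_eq {π : Finpartition (univ : Finset (Fin n))}
    {z : Fin n → β} (h : tiePartition z = π) :
    ∃ σ : π.parts ↪ β, (fun i => σ (blockOf π i)) = z := by
  rw [tiePartition_eq_iff] at h
  choose rep rep_spec using blockOf_surjective π
  refine ⟨⟨fun B => z (rep B), fun B C hBC => ?_⟩, ?_⟩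
  · rwa [h, ← blockOf_eq_blockOf_iff, rep_spec, rep_spec] at hBC
  · funext i
    exact (h _ _).2 ((blockOf_eq_blockOf_iff ..).1 (rep_spec _))

lemma sum_filter_tiePartition_eq {ι M : Type*} [Fintype ι] [DecidableEq ι] [AddCommMonoid M]
    (π : Finpartition (univ : Finset (Fin n))) (F : (Fin n → ι) → M) :
    ∑ κ : Fin n → ι with tiePartition κ = π, F κ =
      ∑ σ : π.parts ↪ ι, F fun i => σ (blockOf π i) := by
  refine (Finset.sum_bij (fun (σ : π.parts ↪ ι) _ i => σ (blockOf π i)) ?_ ?_ ?_ ?_).symm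
  · intro σ _
    rw [mem_filter_univ, tiePartition_comp_blockOf]
  · intro σ _ τ _ h
    ext B
    obtain ⟨i, rfl⟩ := blockOf_surjective π B
    exact congrFun h i
  · intro κ hκ
    obtain ⟨σ, hσ⟩ := exists_embedding_of_tiePartition_eq (mem_filter.1 hκ).2
    exact ⟨σ, mem_univ _, hσ⟩
  · exact fun _ _ => rfl

lemma card_filter_tiePartition_eq (π : Finpartition (univ : Finset (Fin n))) :
    #{c : Fin n → Fin #π.parts | tiePartition c = π} = (#π.parts).factorial := by
  rw [card_eq_sum_ones, sum_filter_tiePartition_eq]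
  simp [Fintype.card_embedding_eq, Nat.descFactorial_self]

/-- The number of data points that carry the label `k`. -/
def labelCount (c : Fin n → β) (k : β) : ℕ :=
  #{i | c i = k}

lemma tiePartition_parts (c : Fin n → β) :
    (tiePartition c).parts = (univ.image c).image fun k => univ.filter fun i => c i = k := by
  rw [← image_part_univ, image_image]
  congr 1
  ext j i
  simp [mem_part_tiePartition, eq_comm]

lemma map_card_parts_tiePartition (c : Fin n → β) :
    (tiePartition c).parts.val.map card = (univ.image c).val.map (labelCount c) := by
  have fibre_injOn : Set.InjOn (fun k => ({i | c i = k} : Finset (Fin n)))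
      (univ.image c : Finset β) := by
    intro k hk k' _ h
    obtain ⟨i, -, rfl⟩ := mem_image.1 hk
    simpa using Finset.ext_iff.1 h i
  rw [tiePartition_parts, image_val_of_injOn fibre_injOn, Multiset.map_map]
  rfl

lemma card_parts_tiePartition (c : Fin n → β) : #(tiePartition c).parts = #(univ.image c) := by
  have h := congrArg Multiset.card (map_card_parts_tiePartition c)
  rwa [Multiset.card_map, Multiset.card_map] at h

lemma card_parts_tiePartition_eq_card_iff {ι : Type*} [Fintype ι] [DecidableEq ι]
    (c : Fin n → ι) : #(tiePartition c).parts = Fintype.card ι ↔ Function.Surjective c := by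
  rw [card_parts_tiePartition, card_eq_iff_eq_univ, eq_univ_iff_forall]
  simp [Function.Surjective]

lemma sum_surjective_tiePartition {M : Type*} [AddCommMonoid M]
    (h : Finpartition (univ : Finset (Fin n)) → M) :
    ∑ c : Fin n → Fin l with Function.Surjective c, h (tiePartition c) =
      l.factorial • ∑ π : Finpartition (univ : Finset (Fin n)) with #π.parts = l, h π := by
  have surjective_iff (c : Fin n → Fin l) :
      Function.Surjective c ↔ #(tiePartition c).parts = l := by
    simpa using (card_parts_tiePartition_eq_card_iff c).symm
  rw [smul_sum, ← sum_fiberwise_of_maps_to (g := tiePartition)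
    (t := {π : Finpartition (univ : Finset (Fin n)) | #π.parts = l})
    (fun c hc => by simpa [surjective_iff] using hc)]
  refine sum_congr rfl fun π hπ => ?_
  obtain rfl := (mem_filter.1 hπ).2
  rw [filter_filter, ← card_filter_tiePartition_eq, ← sum_const]
  have fibre_eq : univ.filter (fun c : Fin n → Fin #π.parts =>
      Function.Surjective c ∧ tiePartition c = π) = univ.filter fun c => tiePartition c = π :=
    filter_congr fun c _ => and_iff_right_of_imp fun hc => by rw [surjective_iff, hc]
  rw [fibre_eq]
  exact sum_congr rfl fun c hc => by rw [(mem_filter.1 hc).2]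

lemma mem_labellings {u : Fin l → ℕ} {c : Fin n → Fin l} :
    c ∈ labellings n l u ↔ labelCount c = u := by
  simp [labellings, labelCount, funext_iff]

lemma sum_labelCount {ι : Type*} [Fintype ι] [DecidableEq ι] (c : Fin n → ι) :
    ∑ k, labelCount c k = n := by
  simpa [labelCount] using
    (card_eq_sum_card_fiberwise (f := c) (s := univ) (t := univ) (by simp)).symm

lemma labelCount_pos_iff_surjective {c : Fin n → β} :
    (∀ k, 0 < labelCount c k) ↔ Function.Surjective c := by
  simp [labelCount, card_pos, Finset.Nonempty, Function.Surjective]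

lemma sum_eq_of_mem_labellings {u : Fin l → ℕ} {c : Fin n → Fin l}
    (hc : c ∈ labellings n l u) : ∑ k, u k = n := by
  rw [← mem_labellings.1 hc, sum_labelCount]

lemma map_card_parts_of_mem_labellings {u : Fin l → ℕ} (hu : ∀ k, 0 < u k) {c : Fin n → Fin l}
    (hc : c ∈ labellings n l u) :
    (tiePartition c).parts.val.map card = (univ : Finset (Fin l)).val.map u := by
  rw [mem_labellings] at hc
  have c_surjective : Function.Surjective c :=
    labelCount_pos_iff_surjective.1 fun k => hc ▸ hu k
  rw [map_card_parts_tiePartition, image_univ_of_surjective c_surjective, hc]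

lemma factorial_smul_sum_card_parts_eq {M : Type*} [AddCommMonoid M]
    (h : Finpartition (univ : Finset (Fin n)) → M) :
    l.factorial • ∑ π : Finpartition (univ : Finset (Fin n)) with #π.parts = l, h π =
      ∑ u ∈ (univ : Finset (Fin l)).piAntidiag n with ∀ k, 0 < u k,
        ∑ c ∈ labellings n l u, h (tiePartition c) := by
  rw [← sum_surjective_tiePartition, ← sum_fiberwise_of_maps_to (g := labelCount)
    (t := {u ∈ (univ : Finset (Fin l)).piAntidiag n | ∀ k, 0 < u k})]
  · refine sum_congr rfl fun u hu => sum_congr ?_ fun _ _ => rfl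
    ext c
    rw [mem_filter, mem_filter_univ, mem_labellings, ← labelCount_pos_iff_surjective]
    exact and_iff_right_of_imp fun hc => hc ▸ (mem_filter.1 hu).2
  · intro c hc
    rw [mem_filter, mem_piAntidiag, labelCount_pos_iff_surjective]
    exact ⟨⟨sum_labelCount c, fun k _ => mem_univ k⟩, (mem_filter.1 hc).2⟩

lemma sum_X_pow_eq_sum_monomial_labelCount (R ι : Type*) [CommSemiring R] [Fintype ι]
    [DecidableEq ι] (n : ℕ) :
    (∑ k, MvPolynomial.X k : MvPolynomial ι R) ^ n =
      ∑ c : Fin n → ι, MvPolynomial.monomial (Finsupp.equivFunOnFinite.symm (labelCount c)) 1 := by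
  rw [← Fin.prod_const, prod_univ_sum, Fintype.piFinset_univ]
  refine sum_congr rfl fun c _ => ?_
  rw [MvPolynomial.monomial_eq, map_one, one_mul, Finsupp.prod_fintype _ _ (by simp),
    ← prod_fiberwise_of_maps_to (t := univ) (g := c) (fun _ _ => mem_univ _)]
  refine prod_congr rfl fun k _ => ?_
  rw [prod_congr rfl fun i hi => by rw [(mem_filter.1 hi).2], prod_const]
  rfl

/-- Both sides are the coefficient of `∏ₖ Xₖ ^ uₖ` in `(∑ₖ Xₖ) ^ n`. -/
lemma card_labellings {u : Fin l → ℕ} (hu : ∑ k, u k = n) :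
    #(labellings n l u) = Nat.multinomial univ u := by
  have prod_X_pow (v : Fin l → ℕ) : (∏ k, (MvPolynomial.X k : MvPolynomial (Fin l) ℕ) ^ v k) =
      MvPolynomial.monomial (Finsupp.equivFunOnFinite.symm v) 1 := by
    rw [MvPolynomial.monomial_eq, Finsupp.prod_fintype _ _ (by simp)]
    simp
  have expansions := sum_X_pow_eq_sum_monomial_labelCount ℕ (Fin l) n
  rw [sum_pow_eq_sum_piAntidiag] at expansions
  have coeff_u := congrArg (MvPolynomial.coeff (Finsupp.equivFunOnFinite.symm u)) expansions
  simp only [prod_X_pow, MvPolynomial.coeff_sum, MvPolynomial.coeff_monomial,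
    EmbeddingLike.apply_eq_iff_eq, ← MvPolynomial.C_eq_coe_nat, MvPolynomial.coeff_C_mul,
    mul_ite, mul_one, mul_zero, sum_ite_eq', mem_piAntidiag] at coeff_u
  rw [if_pos ⟨hu, fun k _ => mem_univ k⟩, ← card_filter] at coeff_u
  rw [← Nat.cast_id (Nat.multinomial univ u), coeff_u]
  congr 1
  ext c
  rw [mem_labellings, mem_filter_univ]

lemma cast_card_labellings {u : Fin l → ℕ} (hu : ∑ k, u k = n) :
    (#(labellings n l u) : ℝ) = (n.factorial : ℝ) / ∏ k, ((u k).factorial : ℝ) := by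
  have h := Nat.multinomial_spec univ u
  rw [hu] at h
  rw [card_labellings hu, eq_div_iff (by positivity), ← h]
  push_cast
  ring

end Ties

/-! ### Generalized Stirling numbers -/

section Stirling

open Finset

variable {a : ℝ}

/-- The weight `Γ(n - a) / Γ(1 - a)` of a block of size `n`. -/
noncomputable def blockWeight (a : ℝ) (n : ℕ) : ℝ :=
  Real.Gamma ((n : ℝ) - a) / Real.Gamma (1 - a)

lemma blockWeight_one (ha : a < 1) : blockWeight a 1 = 1 := by
  simp [blockWeight, div_self (Real.Gamma_pos_of_pos (sub_pos.2 ha)).ne']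

lemma blockWeight_succ (ha : a < 1) {n : ℕ} (hn : 0 < n) :
    blockWeight a (n + 1) = (n - a) * blockWeight a n := by
  have hn_one : (1 : ℝ) ≤ n := by exact_mod_cast hn
  rw [blockWeight, blockWeight, mul_div_assoc', ← Real.Gamma_add_one (by linarith)]
  congr 2
  push_cast
  ring

lemma blockWeight_pos (ha : a < 1) {n : ℕ} (hn : 0 < n) : 0 < blockWeight a n := by
  have hn_one : (1 : ℝ) ≤ n := by exact_mod_cast hn
  exact div_pos (Real.Gamma_pos_of_pos (by linarith)) (Real.Gamma_pos_of_pos (by linarith))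

/-- The exponential generating function `∑ₙ (Γ(n - a) / Γ(1 - a)) Xⁿ / n!`, over `n ≥ 1`, of the
weights of the blocks. -/
noncomputable def blockSeries (a : ℝ) : PowerSeries ℝ :=
  .mk fun n => if n = 0 then 0 else blockWeight a n / (n.factorial : ℝ)

lemma coeff_zero_blockSeries (a : ℝ) : PowerSeries.coeff 0 (blockSeries a) = 0 := by
  simp [blockSeries]

lemma coeff_blockSeries (a : ℝ) {n : ℕ} (hn : 0 < n) :
    PowerSeries.coeff n (blockSeries a) = blockWeight a n / (n.factorial : ℝ) := by
  simp [blockSeries, hn.ne']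

lemma coeff_pow_eq_sum_piAntidiag {R : Type*} [CommSemiring R] (f : PowerSeries R) (n l : ℕ) :
    PowerSeries.coeff n (f ^ l) =
      ∑ u ∈ (univ : Finset (Fin l)).piAntidiag n, ∏ k, PowerSeries.coeff (u k) f := by
  rw [← Fin.prod_const, PowerSeries.coeff_prod]
  refine sum_bij' (fun u _ => u) (fun u _ => Finsupp.equivFunOnFinite.symm u) ?_ ?_ ?_ ?_ ?_ <;>
    simp

lemma genStirling_eq_coeff (a : ℝ) (n l : ℕ) :
    genStirling a n l =
      (n.factorial : ℝ) / (l.factorial : ℝ) * PowerSeries.coeff n (blockSeries a ^ l) := by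
  rw [genStirling, coeff_pow_eq_sum_piAntidiag, sum_filter]
  congr 1
  refine sum_congr rfl fun u _ => ?_
  split_ifs with hu
  · exact prod_congr rfl fun k _ => by
      rw [coeff_blockSeries a (hu k), blockWeight, div_div, mul_comm (Real.Gamma (1 - a))]
  · push Not at hu
    obtain ⟨k, hk⟩ := hu
    refine (prod_eq_zero (mem_univ k) ?_).symm
    rw [Nat.le_zero.1 hk, coeff_zero_blockSeries]

lemma genStirling_zero_zero (a : ℝ) : genStirling a 0 0 = 1 := by
  simp [genStirling_eq_coeff]

lemma genStirling_succ_zero (a : ℝ) (n : ℕ) : genStirling a (n + 1) 0 = 0 := by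
  simp [genStirling_eq_coeff, PowerSeries.coeff_one]

lemma genStirling_one (a : ℝ) {n : ℕ} (hn : 0 < n) : genStirling a n 1 = blockWeight a n := by
  rw [genStirling_eq_coeff, pow_one, coeff_blockSeries a hn]
  field_simp
  simp

lemma genStirling_eq_zero_of_lt (a : ℝ) {n l : ℕ} (h : n < l) : genStirling a n l = 0 := by
  have X_dvd : PowerSeries.X ∣ blockSeries a := by
    rw [PowerSeries.X_dvd_iff, ← PowerSeries.coeff_zero_eq_constantCoeff_apply,
      coeff_zero_blockSeries]
  rw [genStirling_eq_coeff, PowerSeries.X_pow_dvd_iff.1 (pow_dvd_pow_of_dvd X_dvd l) n h, mul_zero]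

open PowerSeries in
lemma one_sub_X_mul_derivative_blockSeries (ha : a < 1) :
    (1 - X) * d⁄dX ℝ (blockSeries a) = 1 - C a * blockSeries a := by
  ext n
  rw [sub_mul, one_mul, map_sub, map_sub, coeff_C_mul, coeff_derivative,
    coeff_blockSeries a n.succ_pos, coeff_one]
  rcases n with _ | n
  · simp [coeff_zero_blockSeries, blockWeight_one ha]
  · rw [coeff_succ_X_mul, coeff_derivative, coeff_blockSeries a n.succ_pos,
      blockWeight_succ ha n.succ_pos, Nat.factorial_succ (n + 1), Nat.factorial_succ n]
    push_cast
    field_simp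
    simp [mul_comm]

open PowerSeries in
/-- The coefficient of `X ^ n` in `(1 - X) (W ^ (l + 1))' = (l + 1) W ^ l (1 - a W)`, where
`W = blockSeries a`. -/
lemma genStirling_succ_succ (ha : a < 1) (n l : ℕ) :
    genStirling a (n + 1) (l + 1) =
      genStirling a n l + (n - a * (l + 1)) * genStirling a n (l + 1) := by
  have differential_equation : (1 - X) * d⁄dX ℝ (blockSeries a ^ (l + 1)) =
      C ((l : ℝ) + 1) * blockSeries a ^ l - C (a * (l + 1)) * blockSeries a ^ (l + 1) := by
    have h := one_sub_X_mul_derivative_blockSeries ha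
    rw [derivative_pow, map_mul, map_add, map_one, map_natCast]
    push_cast
    linear_combination ((l : PowerSeries ℝ) + 1) * blockSeries a ^ l * h
  have coeff_X_mul_derivative : coeff n (X * d⁄dX ℝ (blockSeries a ^ (l + 1))) =
      n * coeff n (blockSeries a ^ (l + 1)) := by
    rcases n with _ | n
    · simp
    · rw [coeff_succ_X_mul, coeff_derivative]
      push_cast
      ring
  have recurrence := congrArg (coeff n) differential_equation
  rw [sub_mul, one_mul, map_sub, map_sub, coeff_C_mul, coeff_C_mul, coeff_X_mul_derivative,
    coeff_derivative] at recurrence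
  simp only [genStirling_eq_coeff, Nat.factorial_succ]
  push_cast
  field_simp
  linear_combination recurrence

lemma sum_mul_genStirling_succ (ha : a < 1) (n : ℕ) (f : ℕ → ℝ) :
    ∑ l ∈ range (n + 2), f l * genStirling a (n + 1) l =
      ∑ l ∈ range (n + 1), (f (l + 1) + f l * (n - a * l)) * genStirling a n l := by
  have shifted : ∑ l ∈ range (n + 1), f (l + 1) * (n - a * (l + 1)) * genStirling a n (l + 1) =
      ∑ l ∈ range (n + 1), f l * (n - a * l) * genStirling a n l := by
    rw [sum_range_succ, sum_range_succ', genStirling_eq_zero_of_lt a n.lt_succ_self]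
    rcases n with _ | n
    · simp
    · simp [genStirling_succ_zero]
  rw [sum_range_succ', genStirling_succ_zero, mul_zero, add_zero]
  simp only [add_mul, sum_add_distrib, ← shifted]
  rw [← sum_add_distrib]
  refine sum_congr rfl fun l _ => ?_
  rw [genStirling_succ_succ ha]
  ring

lemma cast_descFactorial_succ (k l : ℕ) :
    (k.descFactorial (l + 1) : ℝ) = (k - l) * k.descFactorial l := by
  rw [Nat.descFactorial_succ]
  push_cast
  rcases le_or_gt l k with h | h
  · rw [Nat.cast_sub h]
  · simp [Nat.descFactorial_of_lt h]

lemma ascPochhammer_eval_neg_mul (ha : a < 1) (n k : ℕ) :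
    (ascPochhammer ℝ n).eval (-(a * k)) =
      ∑ l ∈ range (n + 1), (-a) ^ l * (k.descFactorial l : ℝ) * genStirling a n l := by
  induction n with
  | zero => simp [genStirling_zero_zero]
  | succ n ih =>
    rw [ascPochhammer_succ_eval, ih, sum_mul_genStirling_succ ha, sum_mul]
    refine sum_congr rfl fun l _ => ?_
    rw [cast_descFactorial_succ, pow_succ]
    ring

lemma hasSum_pow_div_factorial_mul_descFactorial (x : ℝ) (l : ℕ) :
    HasSum (fun k : ℕ => 1 / (k.factorial : ℝ) * x ^ k * k.descFactorial l)
      (x ^ l * Real.exp x) := by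
  have head_eq_zero :
      ∑ k ∈ range l, 1 / (k.factorial : ℝ) * x ^ k * k.descFactorial l = 0 :=
    sum_eq_zero fun k hk => by simp [Nat.descFactorial_of_lt (mem_range.1 hk)]
  rw [← hasSum_nat_add_iff' l, head_eq_zero, sub_zero, Real.exp_eq_exp_ℝ]
  convert! (NormedSpace.expSeries_div_hasSum_exp (𝔸 := ℝ) x).mul_left (x ^ l) using 2 with k
  have factorial_eq : ((k + l).factorial : ℝ) = k.factorial * (k + l).descFactorial l := by
    exact_mod_cast (by simpa using (Nat.factorial_mul_descFactorial (Nat.le_add_left l k)).symm)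
  have : ((k + l).descFactorial l : ℝ) ≠ 0 :=
    Nat.cast_ne_zero.2 (by simp [Nat.descFactorial_eq_zero_iff_lt])
  rw [factorial_eq, pow_add]
  field_simp

lemma hasSum_eppfNormalizer {p : ℝ} (ha : a < 1) (ha0 : a ≠ 0) (hp0 : 0 < p) (γ : ℝ) (n : ℕ) :
    HasSum (fun k : ℕ => Real.exp (γ / (a * p ^ a)) *
        (1 / (k.factorial : ℝ) * (-(γ / (a * p ^ a))) ^ k * (ascPochhammer ℝ n).eval (-(a * k))))
      (eppfNormalizer γ a p n) := by
  set y := γ / (a * p ^ a) with hy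
  have termwise : HasSum (fun k : ℕ => ∑ l ∈ range (n + 1),
      (1 / (k.factorial : ℝ) * (-y) ^ k * k.descFactorial l) *
        (Real.exp y * (-a) ^ l * genStirling a n l))
      (∑ l ∈ range (n + 1), ((-y) ^ l * Real.exp (-y)) *
        (Real.exp y * (-a) ^ l * genStirling a n l)) :=
    hasSum_sum fun l _ => (hasSum_pow_div_factorial_mul_descFactorial (-y) l).mul_right _
  have pow_eq (l : ℕ) : γ ^ l * p ^ (-(a * l)) = (-y) ^ l * (-a) ^ l := by
    have : γ * p ^ (-a) = -y * -a := by
      rw [Real.rpow_neg hp0.le, hy]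
      field_simp
    rw [← mul_pow, ← this, mul_pow, ← neg_mul, Real.rpow_mul_natCast hp0.le]
  convert termwise using 1
  · funext k
    rw [ascPochhammer_eval_neg_mul ha, mul_sum, mul_sum]
    refine sum_congr rfl fun l _ => ?_
    ring
  · refine sum_congr rfl fun l _ => ?_
    have exp_cancel : Real.exp (-y) * Real.exp y = 1 := by rw [← Real.exp_add]; simp
    rw [pow_eq]
    linear_combination -(-y) ^ l * (-a) ^ l * genStirling a n l * exp_cancel

end Stirling

/-! ### Exponentially tilted moments of the generalized gamma law -/

section Moments

open Finset

variable {μ : Measure ℝ} {γ a c p θ : ℝ}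

lemma hasDerivAt_genGammaExponent (a : ℝ) {s : ℝ} (hc : 0 < c) (hs : 0 < c + s) :
    HasDerivAt (genGammaExponent a c) ((c + s) ^ (a - 1)) s := by
  have hasDerivAt_shift : HasDerivAt (fun s => c + s) 1 s := (hasDerivAt_id s).const_add c
  unfold genGammaExponent
  split_ifs with h
  · simp only [h, zero_sub, Real.rpow_neg_one]
    convert! (hasDerivAt_shift.div_const c).log (div_pos hs hc).ne' using 1
    field_simp
  · convert! ((hasDerivAt_shift.rpow_const (p := a) (.inl hs.ne')).sub_const (c ^ a)).div_const a
      using 1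
    field_simp

lemma genGammaExponent_eq_gnbExponent (a : ℝ) {t : ℝ} (hp0 : 0 < p) (hp1 : p < 1)
    (ht : t ≤ 1) : genGammaExponent a ((1 - p) / p) (1 - t) = gnbExponent a p t := by
  have one_sub_pos : 0 < 1 - p := by linarith
  have one_sub_mul_nonneg : 0 ≤ 1 - p * t := by nlinarith
  have add_eq : (1 - p) / p + (1 - t) = (1 - p * t) / p := by
    field_simp
    ring
  rw [genGammaExponent, gnbExponent, add_eq]
  split_ifs with h
  · congr 1
    field_simp
  · rw [Real.div_rpow one_sub_mul_nonneg hp0.le, Real.div_rpow one_sub_pos.le hp0.le]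
    field_simp

lemma gnbExponent_zero (a p : ℝ) : gnbExponent a p 0 = clusterRate a p := by
  simp [gnbExponent, clusterRate]

lemma genGammaExponent_one (a : ℝ) (hp0 : 0 < p) (hp1 : p < 1) :
    genGammaExponent a ((1 - p) / p) 1 = clusterRate a p := by
  simpa only [sub_zero, gnbExponent_zero] using
    genGammaExponent_eq_gnbExponent a hp0 hp1 zero_le_one

/-- The closed form of `∫ x ^ n * exp (-s x)` under the law `gGamma(γ, a, 1 / c)`. -/
noncomputable def tiltedMoment (γ a c : ℝ) (n : ℕ) (s : ℝ) : ℝ :=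
  Real.exp (-(γ * genGammaExponent a c s)) *
    ∑ l ∈ range (n + 1), γ ^ l * (c + s) ^ (a * l - n) * genStirling a n l

lemma hasDerivAt_tiltedMoment (ha : a < 1) (γ : ℝ) (n : ℕ) {s : ℝ} (hc : 0 < c)
    (hs : 0 < c + s) :
    HasDerivAt (tiltedMoment γ a c n) (-tiltedMoment γ a c (n + 1) s) s := by
  have hasDerivAt_exp := ((hasDerivAt_genGammaExponent a hc hs).const_mul γ).neg.exp
  have hasDerivAt_sum : HasDerivAt
      (fun s => ∑ l ∈ range (n + 1), γ ^ l * (c + s) ^ (a * l - n) * genStirling a n l)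
      (∑ l ∈ range (n + 1),
        γ ^ l * (1 * (a * l - n) * (c + s) ^ (a * l - n - 1)) * genStirling a n l) s :=
    .fun_sum fun l _ =>
      ((((hasDerivAt_id s).const_add c).rpow_const (.inl hs.ne')).const_mul _).mul_const _
  convert! hasDerivAt_exp.mul hasDerivAt_sum using 1
  rw [tiltedMoment, sum_mul_genStirling_succ ha, mul_assoc, ← mul_add, ← mul_neg]
  congr 1
  rw [mul_sum, ← sum_add_distrib, ← sum_neg_distrib]
  refine sum_congr rfl fun l _ => ?_
  have rpow_shift : (c + s) ^ (a * ((l + 1 : ℕ) : ℝ) - ((n + 1 : ℕ) : ℝ)) =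
      (c + s) ^ (a - 1) * (c + s) ^ (a * l - n) := by
    rw [← Real.rpow_add hs]
    push_cast
    ring_nf
  have exponent_eq : a * (l : ℝ) - ((n + 1 : ℕ) : ℝ) = a * l - n - 1 := by
    push_cast
    ring
  rw [rpow_shift, exponent_eq]
  ring

lemma IsGenGamma.integrable_exp_mul (h : IsGenGamma μ γ a θ) {s : ℝ} (hs : s ≤ 0) :
    Integrable (fun x => Real.exp (s * x)) μ := by
  have := h.isProbabilityMeasure
  refine (integrable_const (1 : ℝ)).mono' (by fun_prop) ?_
  filter_upwards [h.nonneg] with x hx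
  rw [Real.norm_eq_abs, Real.abs_exp]
  exact Real.exp_le_one_iff.2 (mul_nonpos_of_nonpos_of_nonneg hs hx)

lemma IsGenGamma.mem_interior_integrableExpSet (h : IsGenGamma μ γ a θ) {s : ℝ} (hs : s < 0) :
    s ∈ interior (integrableExpSet (fun x : ℝ => x) μ) :=
  mem_interior.2 ⟨Set.Iio 0, fun _ ht => h.integrable_exp_mul (Set.mem_Iio.1 ht).le, isOpen_Iio, hs⟩

lemma IsGenGamma.integrable_pow_mul_exp (h : IsGenGamma μ γ a θ) (n : ℕ) {s : ℝ} (hs : 0 < s) :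
    Integrable (fun x => x ^ n * Real.exp (-(s * x))) μ := by
  simpa only [neg_mul] using integrable_pow_mul_exp_of_mem_interior_integrableExpSet
    (h.mem_interior_integrableExpSet (neg_lt_zero.2 hs)) n

lemma IsGenGamma.integral_pow_mul_exp (h : IsGenGamma μ γ a θ) (ha : a < 1) (hθ : 0 < θ) (n : ℕ)
    {s : ℝ} (hs : 0 < s) :
    ∫ x, x ^ n * Real.exp (-(s * x)) ∂μ = tiltedMoment γ a θ⁻¹ n s := by
  induction n generalizing s with
  | zero => simpa [tiltedMoment, genStirling_zero_zero] using h.laplace s hs.le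
  | succ n ih =>
    have hasDerivAt_integral : HasDerivAt (fun s => ∫ x, x ^ n * Real.exp (-(s * x)) ∂μ)
        (-∫ x, x ^ (n + 1) * Real.exp (-(s * x)) ∂μ) s := by
      simpa [Function.comp_def] using HasDerivAt.comp s (hasDerivAt_integral_pow_mul_exp_real
        (h.mem_interior_integrableExpSet (neg_lt_zero.2 hs)) n) (hasDerivAt_neg s)
    have eventuallyEq : (fun s => ∫ x, x ^ n * Real.exp (-(s * x)) ∂μ) =ᶠ[nhds s]
        tiltedMoment γ a θ⁻¹ n := by
      filter_upwards [lt_mem_nhds hs] with t ht using ih ht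
    exact neg_injective ((eventuallyEq.hasDerivAt_iff.1 hasDerivAt_integral).unique
      (hasDerivAt_tiltedMoment ha γ n (inv_pos.2 hθ) (by positivity)))

lemma pow_mul_eppfNormalizer (hp0 : 0 < p) (γ a : ℝ) (n : ℕ) :
    p ^ n * eppfNormalizer γ a p n =
      ∑ l ∈ range (n + 1), γ ^ l * p ^ (n - a * l) * genStirling a n l := by
  rw [eppfNormalizer, mul_sum]
  refine sum_congr rfl fun l _ => ?_
  rw [sub_eq_add_neg, Real.rpow_add hp0, Real.rpow_natCast]
  ring

lemma IsGenGamma.integral_pow_mul_exp_neg (h : IsGenGamma μ γ a (p / (1 - p))) (ha : a < 1)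
    (hp0 : 0 < p) (hp1 : p < 1) (n : ℕ) :
    ∫ x, x ^ n * Real.exp (-x) ∂μ =
      Real.exp (-(γ * clusterRate a p)) * (p ^ n * eppfNormalizer γ a p n) := by
  have : 0 < 1 - p := by linarith
  have rate_add_one : (1 - p) / p + 1 = p⁻¹ := by
    field_simp
    ring
  have moment := h.integral_pow_mul_exp ha (by positivity) n one_pos
  simp only [one_mul] at moment
  rw [moment, tiltedMoment, inv_div, genGammaExponent_one a hp0 hp1, rate_add_one,
    pow_mul_eppfNormalizer hp0]
  congr 1
  refine sum_congr rfl fun l _ => ?_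
  rw [Real.inv_rpow hp0.le, ← Real.rpow_neg hp0.le, neg_sub]

end Moments

/-! ### The weight of a cluster and the truncated negative binomial law -/

section ClusterWeight

open Finset

variable {a p : ℝ}

/-- The weight `p ^ (n - a) Γ(n - a) / Γ(1 - a)` of a cluster of size `n`. It is the `n`-th moment
of the tilted Lévy measure `x ^ (-1 - a) exp (-x / p) dx / Γ(1 - a)` of the generalized gamma
process. -/
noncomputable def clusterWeight (a p : ℝ) (n : ℕ) : ℝ :=
  p ^ ((n : ℝ) - a) * blockWeight a n

lemma clusterWeight_pos (ha : a < 1) (hp0 : 0 < p) {n : ℕ} (hn : 0 < n) :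
    0 < clusterWeight a p n :=
  mul_pos (Real.rpow_pos_of_pos hp0 _) (blockWeight_pos ha hn)

/-- Only the term `l = 1` of the normalizer is linear in the mass `g`, hence a set of small mass
carries a single atom to leading order. -/
lemma exists_abs_pow_mul_eppfNormalizer_sub_le (a : ℝ) (hp0 : 0 < p) {n : ℕ} (hn : 0 < n) (γ : ℝ) :
    ∃ C, 0 ≤ C ∧ ∀ g, 0 ≤ g → g ≤ γ →
      |p ^ n * eppfNormalizer g a p n - g * clusterWeight a p n| ≤ C * g ^ 2 := by
  obtain ⟨n, rfl⟩ := Nat.exists_eq_succ_of_ne_zero hn.ne'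
  refine ⟨∑ l ∈ range n, |γ| ^ l * |p ^ (((n + 1 : ℕ) : ℝ) - a * ((l + 1 + 1 : ℕ) : ℝ)) *
    genStirling a (n + 1) (l + 1 + 1)|, by positivity, fun g hg0 hg => ?_⟩
  rw [pow_mul_eppfNormalizer hp0, sum_range_succ', sum_range_succ', genStirling_succ_zero,
    zero_add, genStirling_one a n.succ_pos]
  simp only [Nat.succ_eq_add_one, pow_one, Nat.cast_one, mul_one, mul_zero, add_zero]
  rw [mul_assoc g, clusterWeight, add_sub_cancel_right, sum_mul]
  refine (abs_sum_le_sum_abs _ _).trans (sum_le_sum fun l _ => ?_)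
  rw [mul_assoc, abs_mul, abs_of_nonneg (pow_nonneg hg0 _), add_assoc l, pow_add, mul_right_comm]
  gcongr
  exact hg.trans (le_abs_self γ)

lemma ascPochhammer_eval_neg (ha : a < 1) {n : ℕ} (hn : 0 < n) :
    (ascPochhammer ℝ n).eval (-a) = -a * blockWeight a n := by
  induction n, hn using Nat.le_induction with
  | base => simp [blockWeight_one ha]
  | succ n hn ih =>
    rw [ascPochhammer_succ_eval, ih, blockWeight_succ ha hn]
    ring

lemma hasSum_ascPochhammer_mul_pow (b : ℝ) {x : ℝ} (hx : |x| < 1) :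
    HasSum (fun n : ℕ => (ascPochhammer ℝ n).eval b / (n.factorial : ℝ) * x ^ n)
      ((1 - x) ^ (-b)) := by
  have binomial_series := (Real.one_div_one_sub_rpow_hasFPowerSeriesOnBall_zero b).hasSum (y := x)
    (by simpa [enorm_eq_nnnorm] using! hx)
  rw [zero_add, one_div, ← Real.rpow_neg (by linarith [(abs_lt.1 hx).2])] at binomial_series
  convert! binomial_series using 2 with n
  have factorial_mul := Ring.factorial_nsmul_multichoose_eq_ascPochhammer b n
  rw [Polynomial.ascPochhammer_smeval_eq_eval, nsmul_eq_mul] at factorial_mul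
  rw [FormalMultilinearSeries.ofScalars_apply_eq, smul_eq_mul, ← Ring.multichoose_eq,
    ← factorial_mul]
  field_simp

lemma hasSum_clusterWeight (ha : a < 1) (hp0 : 0 < p) (hp1 : p < 1) :
    HasSum (fun n : ℕ => clusterWeight a p (n + 1) / ((n + 1).factorial : ℝ))
      (clusterRate a p) := by
  have abs_lt_one : |p| < 1 := by rwa [abs_of_pos hp0]
  rw [clusterRate]
  split_ifs with h
  · subst h
    convert! Real.hasSum_pow_div_log_of_abs_lt_one abs_lt_one using 2 with n
    have gamma_eq := Real.Gamma_nat_eq_factorial n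
    simp only [clusterWeight, blockWeight, sub_zero, Real.Gamma_one, Real.rpow_natCast,
      Nat.factorial_succ]
    push_cast
    rw [gamma_eq]
    field_simp
  · have tail := (hasSum_nat_add_iff' 1).2 (hasSum_ascPochhammer_mul_pow (-a) abs_lt_one)
    convert! tail.div_const (-a * p ^ a) using 1
    · funext n
      rw [ascPochhammer_eval_neg ha n.succ_pos, clusterWeight, Real.rpow_sub hp0,
        Real.rpow_natCast]
      field_simp
    · simp
      field_simp
      ring

lemma clusterRate_pos (ha : a < 1) (hp0 : 0 < p) (hp1 : p < 1) : 0 < clusterRate a p := by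
  have term_pos (n : ℕ) : 0 < clusterWeight a p (n + 1) / ((n + 1).factorial : ℝ) :=
    div_pos (clusterWeight_pos ha hp0 n.succ_pos) (by positivity)
  exact (term_pos 0).trans_le
    (le_hasSum (hasSum_clusterWeight ha hp0 hp1) 0 fun n _ => (term_pos n).le)

lemma tnbPMFReal_zero (a p : ℝ) : tnbPMFReal a p 0 = 0 :=
  if_pos rfl

lemma tnbPMFReal_eq_clusterWeight_div (ha : a < 1) (hp0 : 0 < p) (hp1 : p < 1) {u : ℕ}
    (hu : 0 < u) :
    tnbPMFReal a p u = clusterWeight a p u / ((u.factorial : ℝ) * clusterRate a p) := by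
  have one_sub_pos : 0 < 1 - p := by linarith
  have rate_ne_zero := (clusterRate_pos ha hp0 hp1).ne'
  rw [tnbPMFReal, if_neg hu.ne', clusterWeight, blockWeight, Real.rpow_sub hp0, Real.rpow_natCast]
  rw [clusterRate] at rate_ne_zero ⊢
  split_ifs at rate_ne_zero ⊢ with h
  · subst h
    obtain ⟨u, rfl⟩ := Nat.exists_eq_succ_of_ne_zero hu.ne'
    have gamma_eq := Real.Gamma_nat_eq_factorial u
    push_cast at rate_ne_zero ⊢
    rw [sub_zero, sub_zero, gamma_eq, Real.Gamma_one, Nat.factorial_succ, Real.rpow_zero]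
    have log_ne_zero : Real.log (1 - p) ≠ 0 := by simpa using rate_ne_zero
    push_cast
    field_simp
  · have gamma_one_sub : Real.Gamma (1 - a) = -a * Real.Gamma (-a) := by
      rw [← Real.Gamma_add_one (neg_ne_zero.2 h), neg_add_eq_sub]
    have gamma_ne_zero : Real.Gamma (-a) ≠ 0 := right_ne_zero_of_mul
      (gamma_one_sub ▸ (Real.Gamma_pos_of_pos (sub_pos.2 ha)).ne')
    have one_sub_rpow_ne_zero : 1 - (1 - p) ^ a ≠ 0 := (div_ne_zero_iff.1 rate_ne_zero).1
    have one_sub_inv : 1 - ((1 - p) ^ a)⁻¹ = -((1 - (1 - p) ^ a) / (1 - p) ^ a) := by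
      field_simp
      ring
    rw [gamma_one_sub, Real.rpow_neg one_sub_pos.le, one_sub_inv]
    field_simp

lemma tnbPMFReal_nonneg (ha : a < 1) (hp0 : 0 < p) (hp1 : p < 1) (u : ℕ) :
    0 ≤ tnbPMFReal a p u := by
  rcases Nat.eq_zero_or_pos u with rfl | hu
  · exact (tnbPMFReal_zero a p).ge
  · rw [tnbPMFReal_eq_clusterWeight_div ha hp0 hp1 hu]
    have := clusterWeight_pos ha hp0 hu
    have := clusterRate_pos ha hp0 hp1
    positivity

lemma hasSum_tnbPMFReal (ha : a < 1) (hp0 : 0 < p) (hp1 : p < 1) :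
    HasSum (tnbPMFReal a p) 1 := by
  rw [← hasSum_nat_add_iff' 1, sum_range_one, tnbPMFReal_zero, sub_zero,
    ← div_self (clusterRate_pos ha hp0 hp1).ne']
  convert! (hasSum_clusterWeight ha hp0 hp1).div_const (clusterRate a p) using 2 with n
  rw [tnbPMFReal_eq_clusterWeight_div ha hp0 hp1 n.succ_pos, div_div]

lemma tnbMeasure_singleton (a p : ℝ) (u : ℕ) :
    tnbMeasure a p {u} = ENNReal.ofReal (tnbPMFReal a p u) := by
  rw [tnbMeasure, Measure.sum_smul_dirac_singleton]

lemma isProbabilityMeasure_tnbMeasure (ha : a < 1) (hp0 : 0 < p) (hp1 : p < 1) :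
    IsProbabilityMeasure (tnbMeasure a p) :=
  (hasSum_tnbPMFReal ha hp0 hp1).isProbabilityMeasure_sum_dirac (tnbPMFReal_nonneg ha hp0 hp1)

end ClusterWeight

/-! ### Sums over injective assignments -/

section Embeddings

open Filter Finset
open scoped Topology

variable {β : Type*} [Fintype β]

lemma sum_embedding_eq_sum_injective {ι M : Type*} [DecidableEq β] [Fintype ι] [DecidableEq ι]
    [AddCommMonoid M] (F : (β → ι) → M) :
    ∑ σ : β ↪ ι, F σ = ∑ σ : β → ι with Function.Injective σ, F σ := by
  rw [← sum_subtype_eq_sum_filter, subtype_univ]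
  exact (Fintype.sum_equiv (Equiv.subtypeInjectiveEquivEmbedding β ι) _ _ fun σ => rfl).symm

lemma sum_prod_filter_apply_eq_apply {ι R : Type*} [DecidableEq β] [Fintype ι] [DecidableEq ι]
    [CommSemiring R] (g : β → ι → R) {b b' : β} (hb : b ≠ b') :
    ∑ σ : β → ι with σ b = σ b', ∏ c, g c (σ c) =
      (∑ j, g b j * g b' j) * ∏ c ∈ {b, b'}ᶜ, ∑ j, g c j := by
  rw [← sum_fiberwise _ (fun σ => σ b), sum_mul]
  refine sum_congr rfl fun j _ => ?_
  let values (c : β) : Finset ι := if c ∈ ({b, b'} : Finset β) then {j} else univ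
  have filter_eq : (univ.filter fun σ : β → ι => σ b = σ b').filter (fun σ => σ b = j) =
      Fintype.piFinset values := by
    ext σ
    simp only [mem_filter, Fintype.mem_piFinset, values]
    constructor
    · rintro ⟨h, rfl⟩ c
      split_ifs with hc
      · rcases mem_insert.1 hc with rfl | hc
        · simp
        · simp [mem_singleton.1 hc, h]
      · exact mem_univ _
    · intro h
      have h_left := h b
      have h_right := h b'
      simp_all
  rw [filter_eq, ← prod_univ_sum, ← prod_mul_prod_compl {b, b'}]
  congr 1
  · rw [prod_pair hb]
    simp [values]
  · refine prod_congr rfl fun c hc => ?_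
    simp only [values, if_neg (mem_compl.1 hc)]

lemma sum_le_sum_sum_filter {ι κ : Type*} {s : Finset ι} {t : Finset κ} {F : ι → ℝ}
    {r : κ → ι → Prop} [∀ k, DecidablePred (r k)] (hF : ∀ i ∈ s, 0 ≤ F i)
    (hr : ∀ i ∈ s, ∃ k ∈ t, r k i) : ∑ i ∈ s, F i ≤ ∑ k ∈ t, ∑ i ∈ s with r k i, F i := by
  simp only [sum_filter]
  rw [sum_comm]
  refine sum_le_sum fun i hi => ?_
  obtain ⟨k, hk, hki⟩ := hr i hi
  refine (if_pos hki).ge.trans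
    (single_le_sum (f := fun k => if r k i then F i else 0) (fun k _ => ?_) hk)
  split_ifs
  exacts [hF i hi, le_rfl]

lemma abs_sum_prod_not_injective_le {ι : Type*} [DecidableEq β] [Fintype ι] [DecidableEq ι]
    (g : β → ι → ℝ) :
    |∑ σ : β → ι with ¬Function.Injective σ, ∏ c, g c (σ c)| ≤
      ∑ b ∈ (univ : Finset β).offDiag,
        (∑ j, |g b.1 j * g b.2 j|) * ∏ c ∈ {b.1, b.2}ᶜ, ∑ j, |g c j| := by
  have exists_pair (σ : β → ι) (hσ : σ ∈ univ.filter fun σ : β → ι => ¬Function.Injective σ) :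
      ∃ b ∈ (univ : Finset β).offDiag, σ b.1 = σ b.2 := by
    obtain ⟨b, b', h, hb⟩ : ∃ b b', σ b = σ b' ∧ b ≠ b' := by
      simpa [Function.Injective] using hσ
    exact ⟨(b, b'), by simpa using hb, h⟩
  refine (abs_sum_le_sum_abs _ _).trans ((sum_le_sum_sum_filter (fun σ _ => abs_nonneg _)
    exists_pair).trans (sum_le_sum fun b hb => ?_))
  have hb_ne : b.1 ≠ b.2 := (mem_offDiag.1 hb).2.2
  have filter_eq : (univ.filter fun σ : β → ι => ¬Function.Injective σ).filter
      (fun σ => σ b.1 = σ b.2) = univ.filter fun σ => σ b.1 = σ b.2 := by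
    rw [filter_filter]
    exact filter_congr fun σ _ => and_iff_right_of_imp fun h hσ => hb_ne (hσ h)
  simp only [filter_eq, abs_prod, abs_mul]
  exact (sum_prod_filter_apply_eq_apply (fun c j => |g c j|) hb_ne).le

/-- Assignments that are not injective lose a factor `∑ j, |q b j * q b' j|`, so in the limit the
sum over embeddings factors like the sum over all maps. -/
lemma tendsto_sum_embedding {ι : ℕ → Type*} [∀ N, Fintype (ι N)] {q : ∀ N, β → ι N → ℝ}
    {L D : β → ℝ} (hL : ∀ b, Tendsto (fun N => ∑ j, q N b j) atTop (𝓝 (L b)))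
    (hD : ∀ N b, ∑ j, |q N b j| ≤ D b)
    (h0 : ∀ b b', b ≠ b' → Tendsto (fun N => ∑ j, |q N b j * q N b' j|) atTop (𝓝 0)) :
    Tendsto (fun N => ∑ σ : β ↪ ι N, ∏ b, q N b (σ b)) atTop (𝓝 (∏ b, L b)) := by
  classical
  have tendsto_all : Tendsto (fun N => ∑ σ : β → ι N, ∏ b, q N b (σ b)) atTop
      (𝓝 (∏ b, L b)) := by
    simp only [← Fintype.piFinset_univ, ← prod_univ_sum]
    exact tendsto_finsetProd _ fun b _ => hL b
  have tendsto_not_injective : Tendsto (fun N => ∑ σ : β → ι N with ¬Function.Injective σ,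
      ∏ b, q N b (σ b)) atTop (𝓝 0) := by
    refine squeeze_zero_norm (a := fun N => ∑ b ∈ (univ : Finset β).offDiag,
      (∑ j, |q N b.1 j * q N b.2 j|) * ∏ c ∈ {b.1, b.2}ᶜ, D c) (fun N => ?_) ?_
    · refine (abs_sum_prod_not_injective_le (q N)).trans (sum_le_sum fun b _ => ?_)
      gcongr with c
      exact hD N c
    · rw [← sum_const_zero (s := (univ : Finset β).offDiag)]
      refine tendsto_finsetSum _ fun b hb => ?_
      simpa using (h0 b.1 b.2 (mem_offDiag.1 hb).2.2).mul_const (∏ c ∈ {b.1, b.2}ᶜ, D c)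
  have tendsto_sub := tendsto_all.sub tendsto_not_injective
  rw [sub_zero] at tendsto_sub
  refine tendsto_sub.congr fun N => ?_
  rw [sum_embedding_eq_sum_injective fun σ => ∏ b, q N b (σ b), sub_eq_iff_eq_add]
  exact (sum_filter_add_sum_filter_not _ _ _).symm

lemma tendsto_sum_of_abs_sub_le {ι : ℕ → Type*} [∀ N, Fintype (ι N)] {g : ∀ N, ι N → ℝ}
    {γ C κ : ℝ} {f : ℝ → ℝ} (hg0 : ∀ N j, 0 ≤ g N j) (hg1 : ∀ N, ∑ j, g N j = γ)
    (hg2 : Tendsto (fun N => ∑ j, g N j ^ 2) atTop (𝓝 0))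
    (hf : ∀ x, 0 ≤ x → x ≤ γ → |f x - x * κ| ≤ C * x ^ 2) :
    Tendsto (fun N => ∑ j, f (g N j)) atTop (𝓝 (γ * κ)) := by
  have le_total (N j) : g N j ≤ γ :=
    hg1 N ▸ single_le_sum (fun i _ => hg0 N i) (mem_univ j)
  rw [tendsto_iff_norm_sub_tendsto_zero]
  refine squeeze_zero (fun _ => norm_nonneg _) (g := fun N => C * ∑ j, g N j ^ 2)
    (fun N => ?_) (by simpa using hg2.const_mul C)
  rw [← hg1 N, sum_mul, ← sum_sub_distrib, mul_sum]
  exact (abs_sum_le_sum_abs _ _).trans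
    (sum_le_sum fun j _ => hf _ (hg0 N j) (le_total N j))

lemma tendsto_sum_embedding_of_abs_sub_le {ι : ℕ → Type*} [∀ N, Fintype (ι N)]
    {g : ∀ N, ι N → ℝ} {γ : ℝ} (hg0 : ∀ N j, 0 ≤ g N j) (hg1 : ∀ N, ∑ j, g N j = γ)
    (hg2 : Tendsto (fun N => ∑ j, g N j ^ 2) atTop (𝓝 0)) {f : β → ℝ → ℝ} {κ : β → ℝ}
    (hf : ∀ b, ∃ C, 0 ≤ C ∧ ∀ x, 0 ≤ x → x ≤ γ → |f b x - x * κ b| ≤ C * x ^ 2) :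
    Tendsto (fun N => ∑ σ : β ↪ ι N, ∏ b, f b (g N (σ b))) atTop (𝓝 (∏ b, γ * κ b)) := by
  choose C hC0 hC using hf
  have le_total (N j) : g N j ≤ γ :=
    hg1 N ▸ single_le_sum (fun i _ => hg0 N i) (mem_univ j)
  obtain ⟨D, abs_le⟩ : ∃ D : β → ℝ, ∀ b N j, |f b (g N j)| ≤ D b * g N j := by
    refine ⟨fun b => C b * γ + |κ b|, fun b N j => ?_⟩
    have triangle := abs_add_le (f b (g N j) - g N j * κ b) (g N j * κ b)
    rw [sub_add_cancel, abs_mul, abs_of_nonneg (hg0 N j)] at triangle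
    have square_le : C b * g N j ^ 2 ≤ C b * γ * g N j := by
      rw [sq, ← mul_assoc]
      exact mul_le_mul_of_nonneg_right
        (mul_le_mul_of_nonneg_left (le_total N j) (hC0 b)) (hg0 N j)
    linarith [hC b (g N j) (hg0 N j) (le_total N j), add_mul (C b * γ) |κ b| (g N j)]
  refine tendsto_sum_embedding (q := fun N b j => f b (g N j)) (D := fun b => D b * γ)
    (fun b => tendsto_sum_of_abs_sub_le hg0 hg1 hg2 (hC b)) (fun N b => ?_) fun b b' _ => ?_
  · rw [← hg1 N, mul_sum]
    exact sum_le_sum fun j _ => abs_le b N j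
  · refine squeeze_zero (fun N => sum_nonneg fun j _ => abs_nonneg _)
      (g := fun N => D b * D b' * ∑ j, g N j ^ 2) (fun N => ?_)
      (by simpa using hg2.const_mul (D b * D b'))
    rw [mul_sum]
    refine sum_le_sum fun j _ => ?_
    rw [abs_mul, sq, mul_mul_mul_comm]
    exact mul_le_mul (abs_le b N j) (abs_le b' N j) (abs_nonneg _)
      ((abs_nonneg _).trans (abs_le b N j))

end Embeddings

/-! ### Cells of a separating sequence -/

section Cells

open Filter Finset
open scoped Topology

variable {S : Type*}

/-- The cell of `s` in the partition of `S` into at most `2 ^ N` sets given by the first `N` bits of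
a map to the Cantor space. The cells of an injective map eventually separate any two points. -/
def cell (f : S → ℕ → Bool) (N : ℕ) (s : S) : Fin N → Bool := fun i => f s i

lemma eventually_cell_eq_iff {f : S → ℕ → Bool} (hf : Function.Injective f) (s t : S) :
    ∀ᶠ N in atTop, cell f N s = cell f N t ↔ s = t := by
  by_cases h : s = t
  · exact .of_forall fun N => by simp [h]
  · obtain ⟨d, hd⟩ := Function.ne_iff.1 (hf.ne h)
    filter_upwards [eventually_gt_atTop d] with N hN
    simp only [h, iff_false]
    exact fun cell_eq => hd (congrFun cell_eq ⟨d, hN⟩)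

variable [MeasurableSpace S]

lemma measurable_cell {f : S → ℕ → Bool} (hf : Measurable f) (N : ℕ) : Measurable (cell f N) :=
  measurable_pi_lambda _ fun i => (measurable_pi_apply (i : ℕ)).comp hf

lemma measurableEq_of_injective {T : Type*} [MeasurableSpace T] [MeasurableEq T] {f : S → T}
    (hf : Measurable f) (hf_inj : Function.Injective f) : MeasurableEq S where
  measurableSet_diagonal := by
    have measurableSet_eq : MeasurableSet {q : S × S | f q.1 = f q.2} :=
      measurableSet_eq_fun (hf.comp measurable_fst) (hf.comp measurable_snd)
    simpa only [hf_inj.eq_iff, Set.diagonal] using measurableSet_eq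

lemma prod_diagonal_eq_zero [MeasurableEq S] (μ ν : Measure S) [SFinite ν]
    [NullSingletonClass ν] : μ.prod ν (Set.diagonal S) = 0 := by
  have section_eq (s : S) : Prod.mk s ⁻¹' Set.diagonal S = {s} := by
    ext t
    simp [eq_comm]
  simp [Measure.prod_apply measurableSet_diagonal, section_eq]

variable {ι : Type*} [Fintype ι] [MeasurableSpace ι] [MeasurableSingletonClass ι]
  (μ : Measure S) [IsFiniteMeasure μ] {h : S → ι}

lemma sum_measureReal_preimage_singleton_univ (hh : Measurable h) :
    ∑ j, μ.real (h ⁻¹' {j}) = μ.real Set.univ := by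
  rw [sum_measureReal_preimage_singleton _ fun j _ => hh (measurableSet_singleton j), coe_univ,
    Set.preimage_univ]

lemma sum_sq_measureReal_preimage_singleton (hh : Measurable h) :
    ∑ j, μ.real (h ⁻¹' {j}) ^ 2 = (μ.prod μ).real {q | h q.1 = h q.2} := by
  have setOf_eq : {q : S × S | h q.1 = h q.2} =
      ⋃ j ∈ (univ : Finset ι), (h ⁻¹' {j}) ×ˢ (h ⁻¹' {j}) := by
    ext q
    simp [eq_comm]
  rw [setOf_eq, measureReal_biUnion_finset]
  · exact sum_congr rfl fun j _ => by rw [measureReal_prod_prod, sq]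
  · intro i _ j _ hij
    refine Set.disjoint_left.2 fun q hi hj => hij ?_
    rw [← hi.1, ← hj.1]
  · exact fun j _ => (hh (measurableSet_singleton j)).prod (hh (measurableSet_singleton j))

/-- The sum of squares is the mass that the product measure gives to pairs in a common cell, and
these sets shrink to the diagonal. -/
lemma tendsto_sum_cell_sq [NullSingletonClass μ] {f : S → ℕ → Bool} (hf : Measurable f)
    (hf_inj : Function.Injective f) :
    Tendsto (fun N => ∑ j, μ.real (cell f N ⁻¹' {j}) ^ 2) atTop (𝓝 0) := by
  have := measurableEq_of_injective hf hf_inj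
  have tendsto_prod := tendsto_measure_of_tendsto_indicator_of_isFiniteMeasure
    (A := Set.diagonal S) atTop (μ.prod μ) (As := fun N => {q | cell f N q.1 = cell f N q.2})
    (fun N => measurableSet_eq_fun ((measurable_cell hf N).comp measurable_fst)
      ((measurable_cell hf N).comp measurable_snd))
    (fun q => eventually_cell_eq_iff hf_inj q.1 q.2)
  rw [prod_diagonal_eq_zero] at tendsto_prod
  simp only [fun N => sum_sq_measureReal_preimage_singleton μ (measurable_cell hf N)]
  exact (ENNReal.tendsto_toReal_zero_iff fun N => measure_ne_top _ _).2 tendsto_prod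

end Cells

/-! ### Tilted moments of a generalized gamma process -/

section GammaProcess

open Filter Finset
open scoped Topology

lemma genStirling_nonneg {a : ℝ} (ha : a < 1) (n l : ℕ) : 0 ≤ genStirling a n l := by
  refine mul_nonneg (by positivity) (sum_nonneg fun u hu => prod_nonneg fun k _ => ?_)
  have one_le : (1 : ℝ) ≤ u k := Nat.one_le_cast.2 ((mem_filter.1 hu).2 k)
  exact div_nonneg (Real.Gamma_nonneg_of_nonneg (by linarith))
    (mul_nonneg (by positivity) (Real.Gamma_nonneg_of_nonneg (by linarith)))

lemma eppfNormalizer_nonneg {γ a p : ℝ} (ha : a < 1) (hp0 : 0 < p) (hγ : 0 ≤ γ) (n : ℕ) :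
    0 ≤ eppfNormalizer γ a p n :=
  sum_nonneg fun l _ => mul_nonneg (by positivity) (genStirling_nonneg ha n l)

lemma eppfNormalizer_zero (γ a p : ℝ) : eppfNormalizer γ a p 0 = 1 := by
  simp [eppfNormalizer, genStirling_zero_zero]

lemma prod_labelCount_comp_blockOf {ι M : Type*} [Fintype ι] [DecidableEq ι]
    [CommMonoid M] {n : ℕ} (π : Finpartition (univ : Finset (Fin n))) (σ : π.parts ↪ ι)
    {F : ι → ℕ → M}
    (hF : ∀ j, F j 0 = 1) :
    ∏ j, F j (labelCount (fun i => σ (blockOf π i)) j) = ∏ B, F (σ B) #B.1 := by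
  refine (Fintype.prod_of_injective σ σ.injective _ _ (fun j hj => ?_) fun B => ?_).symm
  · have labelCount_eq_zero : labelCount (fun i => σ (blockOf π i)) j = 0 :=
      card_eq_zero.2 (filter_false_of_mem fun i _ hi => hj ⟨_, hi⟩)
    rw [labelCount_eq_zero, hF]
  · rw [labelCount, ← filter_blockOf_eq π B]
    simp only [σ.injective.eq_iff]

variable {Ω S : Type*} [MeasurableSpace Ω] [MeasurableSpace S] {P : Measure Ω}
  {G : Ω → Measure S} {G₀ : Measure S} {a c p : ℝ}

lemma IsGenGammaProcess.measurable_apply (hG : IsGenGammaProcess P G G₀ a c) {A : Set S}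
    (hA : MeasurableSet A) : Measurable fun ω => G ω A :=
  (Measure.measurable_coe hA).comp hG.measurable

lemma IsGenGammaProcess.measurable_real (hG : IsGenGammaProcess P G G₀ a c) {A : Set S}
    (hA : MeasurableSet A) : Measurable fun ω => (G ω).real A :=
  (hG.measurable_apply hA).ennreal_toReal

lemma IsGenGammaProcess.lintegral_pow_mul_exp_neg (hG : IsGenGammaProcess P G G₀ a ((1 - p) / p))
    (ha : a < 1) (hp0 : 0 < p) (hp1 : p < 1) {A : Set S} (hA : MeasurableSet A) (n : ℕ) :
    ∫⁻ ω, ENNReal.ofReal ((G ω).real A ^ n * Real.exp (-(G ω).real A)) ∂P =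
      ENNReal.ofReal (Real.exp (-(G₀.real A * clusterRate a p)) *
        (p ^ n * eppfNormalizer (G₀.real A) a p n)) := by
  have law := hG.law A hA
  rw [inv_div] at law
  have integrable := law.integrable_pow_mul_exp n one_pos
  simp only [one_mul] at integrable
  rw [← law.integral_pow_mul_exp_neg ha hp0 hp1 n, ofReal_integral_eq_lintegral_ofReal integrable,
    lintegral_map (by fun_prop) (hG.measurable_real hA)]
  filter_upwards [law.nonneg] with x hx
  positivity

variable {ι : Type*} [MeasurableSpace ι] [MeasurableSingletonClass ι] {h : S → ι}

lemma IsGenGammaProcess.iIndepFun_preimage [Finite ι] (hG : IsGenGammaProcess P G G₀ a c)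
    (hh : Measurable h) : iIndepFun (fun j ω => G ω (h ⁻¹' {j})) P := by
  let e := Finite.equivFin ι
  have indep := hG.indep (Nat.card ι) (fun i => h ⁻¹' {e.symm i})
    (fun i => hh (measurableSet_singleton _)) fun i j hij =>
      (Set.disjoint_singleton.2 (e.symm.injective.ne hij)).preimage h
  simpa using indep.precomp e.injective

variable [Fintype ι] [DecidableEq ι]

lemma exp_neg_mul_prod_measure_preimage (μ : Measure S) [IsFiniteMeasure μ] (hh : Measurable h)
    {n : ℕ} (κ : Fin n → ι) :
    ENNReal.ofReal (Real.exp (-μ.real Set.univ)) * ∏ i, μ (h ⁻¹' {κ i}) =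
      ∏ j, ENNReal.ofReal (μ.real (h ⁻¹' {j}) ^ labelCount κ j *
        Real.exp (-μ.real (h ⁻¹' {j}))) := by
  have prod_eq : ∏ i, μ (h ⁻¹' {κ i}) =
      ∏ j, ENNReal.ofReal (μ.real (h ⁻¹' {j}) ^ labelCount κ j) := by
    rw [← Fintype.prod_fiberwise' κ fun j => μ (h ⁻¹' {j})]
    refine prod_congr rfl fun j _ => ?_
    rw [prod_const, ENNReal.ofReal_pow measureReal_nonneg, ofReal_measureReal]
    simp [labelCount, Fintype.card_subtype]
  rw [← sum_measureReal_preimage_singleton_univ μ hh, ← sum_neg_distrib, Real.exp_sum,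
    ENNReal.ofReal_prod_of_nonneg fun j _ => (Real.exp_pos _).le, prod_eq, ← prod_mul_distrib]
  refine prod_congr rfl fun j _ => ?_
  rw [mul_comm, ENNReal.ofReal_mul (by positivity)]

lemma IsGenGammaProcess.lintegral_exp_mul_prod [IsFiniteMeasure G₀]
    (hG : IsGenGammaProcess P G G₀ a ((1 - p) / p)) (ha : a < 1) (hp0 : 0 < p) (hp1 : p < 1)
    (hh : Measurable h) {n : ℕ} (κ : Fin n → ι) :
    ∫⁻ ω, ENNReal.ofReal (Real.exp (-(G ω).real Set.univ)) * ∏ i, G ω (h ⁻¹' {κ i}) ∂P =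
      ENNReal.ofReal (Real.exp (-(G₀.real Set.univ * clusterRate a p)) *
        ∏ j, (p ^ labelCount κ j *
          eppfNormalizer (G₀.real (h ⁻¹' {j})) a p (labelCount κ j))) := by
  have measurableSet_preimage (j : ι) : MeasurableSet (h ⁻¹' {j}) := hh (measurableSet_singleton j)
  have indep := (hG.iIndepFun_preimage hh).comp
    (fun j x => ENNReal.ofReal (x.toReal ^ labelCount κ j * Real.exp (-x.toReal)))
    (fun j => by fun_prop)
  calc ∫⁻ ω, ENNReal.ofReal (Real.exp (-(G ω).real Set.univ)) * ∏ i, G ω (h ⁻¹' {κ i}) ∂P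
      = ∫⁻ ω, ∏ j, ENNReal.ofReal ((G ω).real (h ⁻¹' {j}) ^ labelCount κ j *
          Real.exp (-(G ω).real (h ⁻¹' {j}))) ∂P := by
        refine lintegral_congr_ae ?_
        filter_upwards [hG.finite] with ω hω
        have : IsFiniteMeasure (G ω) := ⟨hω⟩
        exact exp_neg_mul_prod_measure_preimage (G ω) hh κ
    _ = ∏ j, ∫⁻ ω, ENNReal.ofReal ((G ω).real (h ⁻¹' {j}) ^ labelCount κ j *
          Real.exp (-(G ω).real (h ⁻¹' {j}))) ∂P :=
        lintegral_prod_eq_prod_lintegral_of_indepFun univ _ indep fun j =>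
          (((hG.measurable_real (measurableSet_preimage j)).pow_const _).mul
            (hG.measurable_real (measurableSet_preimage j)).neg.exp).ennreal_ofReal
    _ = ENNReal.ofReal (∏ j, (Real.exp (-(G₀.real (h ⁻¹' {j}) * clusterRate a p)) *
          (p ^ labelCount κ j *
            eppfNormalizer (G₀.real (h ⁻¹' {j})) a p (labelCount κ j)))) := by
        rw [ENNReal.ofReal_prod_of_nonneg fun j _ => mul_nonneg (Real.exp_pos _).le
          (mul_nonneg (by positivity) (eppfNormalizer_nonneg ha hp0 measureReal_nonneg _))]
        exact prod_congr rfl fun j _ =>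
          hG.lintegral_pow_mul_exp_neg ha hp0 hp1 (measurableSet_preimage j) _
    _ = _ := by
        rw [prod_mul_distrib, ← Real.exp_sum, sum_neg_distrib, ← sum_mul,
          sum_measureReal_preimage_singleton_univ G₀ hh]

lemma IsGenGammaProcess.lintegral_exp_mul_sum_tiePartition [IsFiniteMeasure G₀]
    (hG : IsGenGammaProcess P G G₀ a ((1 - p) / p)) (ha : a < 1) (hp0 : 0 < p) (hp1 : p < 1)
    (hh : Measurable h) {n : ℕ} (π : Finpartition (univ : Finset (Fin n))) :
    ∫⁻ ω, ENNReal.ofReal (Real.exp (-(G ω).real Set.univ)) *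
        ∑ κ : Fin n → ι with tiePartition κ = π, ∏ i, G ω (h ⁻¹' {κ i}) ∂P =
      ENNReal.ofReal (Real.exp (-(G₀.real Set.univ * clusterRate a p)) *
        ∑ σ : π.parts ↪ ι, ∏ B, (p ^ #B.1 *
          eppfNormalizer (G₀.real (h ⁻¹' {σ B})) a p #B.1)) := by
  have measurableSet_preimage (j : ι) : MeasurableSet (h ⁻¹' {j}) := hh (measurableSet_singleton j)
  have measurable_summand (κ : Fin n → ι) : Measurable fun ω =>
      ENNReal.ofReal (Real.exp (-(G ω).real Set.univ)) * ∏ i, G ω (h ⁻¹' {κ i}) :=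
    (hG.measurable_real MeasurableSet.univ).neg.exp.ennreal_ofReal.mul
      (measurable_prod _ fun i _ => hG.measurable_apply (measurableSet_preimage _))
  simp only [mul_sum]
  rw [lintegral_finsetSum _ fun κ _ => measurable_summand κ, ENNReal.ofReal_sum_of_nonneg]
  · simp only [fun κ : Fin n → ι => hG.lintegral_exp_mul_prod ha hp0 hp1 hh κ]
    rw [sum_filter_tiePartition_eq π fun κ : Fin n → ι => _]
    refine sum_congr rfl fun σ _ => ?_
    rw [prod_labelCount_comp_blockOf π σ
      (F := fun j k => p ^ k * eppfNormalizer (G₀.real (h ⁻¹' {j})) a p k)]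
    simp [eppfNormalizer_zero]
  · exact fun σ _ => mul_nonneg (Real.exp_pos _).le (prod_nonneg fun B _ =>
      mul_nonneg (by positivity) (eppfNormalizer_nonneg ha hp0 measureReal_nonneg _))

lemma IsGenGammaProcess.tendsto_lintegral_cell [IsFiniteMeasure G₀] [NullSingletonClass G₀]
    (hG : IsGenGammaProcess P G G₀ a ((1 - p) / p)) (ha : a < 1) (hp0 : 0 < p) (hp1 : p < 1)
    {f : S → ℕ → Bool} (hf : Measurable f) (hf_inj : Function.Injective f) {n : ℕ}
    (π : Finpartition (univ : Finset (Fin n))) :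
    Tendsto (fun N => ∫⁻ ω, ENNReal.ofReal (Real.exp (-(G ω).real Set.univ)) *
        ∑ κ : Fin n → Fin N → Bool with tiePartition κ = π, ∏ i, G ω (cell f N ⁻¹' {κ i}) ∂P)
      atTop (𝓝 (ENNReal.ofReal (Real.exp (-(G₀.real Set.univ * clusterRate a p)) *
        ∏ B : π.parts, G₀.real Set.univ * clusterWeight a p #B.1))) := by
  simp only [fun N => hG.lintegral_exp_mul_sum_tiePartition ha hp0 hp1 (measurable_cell hf N) π]
  refine (ENNReal.continuous_ofReal.tendsto _).comp (Tendsto.const_mul _ ?_)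
  exact tendsto_sum_embedding_of_abs_sub_le (g := fun N j => G₀.real (cell f N ⁻¹' {j}))
    (f := fun (B : π.parts) g => p ^ #B.1 * eppfNormalizer g a p #B.1)
    (fun N j => measureReal_nonneg)
    (fun N => sum_measureReal_preimage_singleton_univ G₀ (measurable_cell hf N))
    (tendsto_sum_cell_sq G₀ hf hf_inj) fun B =>
      exists_abs_pow_mul_eppfNormalizer_sub_le a hp0
        (card_pos.2 (π.nonempty_of_mem_parts B.2)) _

end GammaProcess

/-! ### The count-mixture model -/

section TiePartitionMeasure

open Filter Finset
open scoped Topology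

variable {T : Type*} [MeasurableSpace T] (μ : Measure T) [IsFiniteMeasure μ] {n : ℕ}
  (π : Finpartition (univ : Finset (Fin n)))

lemma pi_tiePartition_comp_eq_sum {ι : Type*} [Fintype ι] [DecidableEq ι] [MeasurableSpace ι]
    [MeasurableSingletonClass ι] {h : T → ι} (hh : Measurable h) :
    Measure.pi (fun _ : Fin n => μ) {t | tiePartition (fun i => h (t i)) = π} =
      ∑ κ : Fin n → ι with tiePartition κ = π, ∏ i, μ (h ⁻¹' {κ i}) := by
  have setOf_eq : {t : Fin n → T | tiePartition (fun i => h (t i)) = π} =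
      ⋃ κ ∈ univ.filter fun κ : Fin n → ι => tiePartition κ = π,
        Set.univ.pi fun i => h ⁻¹' {κ i} := by
    ext t
    simp [Set.mem_pi, ← funext_iff (f := fun i => h (t i))]
  rw [setOf_eq, measure_biUnion_finset]
  · exact sum_congr rfl fun κ _ => Measure.pi_pi _ _
  · intro κ _ κ' _ hne
    refine Set.disjoint_left.2 fun t ht ht' => hne (funext fun i => ?_)
    exact (ht i (Set.mem_univ i)).symm.trans (ht' i (Set.mem_univ i))
  · exact fun κ _ => .univ_pi fun i => hh (measurableSet_singleton _)

lemma tendsto_pi_tiePartition_cell [Countable T] [MeasurableSingletonClass T] {S : Type*}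
    {y : T → S} (hy : ∀ s t, μ {s} ≠ 0 → μ {t} ≠ 0 → y s = y t → s = t) [DecidableEq T]
    {f : S → ℕ → Bool} (hf : Function.Injective f) :
    Tendsto (fun N => Measure.pi (fun _ : Fin n => μ)
        {t | tiePartition (fun i => cell f N (y (t i))) = π}) atTop
      (𝓝 (Measure.pi (fun _ : Fin n => μ) {t | tiePartition t = π})) := by
  refine tendsto_measure_of_ae_tendsto_indicator_of_isFiniteMeasure _ .of_discrete
    (fun _ => .of_discrete) (ae_iff_of_countable.2 fun t ht => ?_)
  rw [Measure.pi_singleton, prod_ne_zero_iff] at ht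
  have separated : ∀ᶠ N in atTop, ∀ i j,
      cell f N (y (t i)) = cell f N (y (t j)) ↔ t i = t j := by
    simp only [eventually_all]
    intro i j
    filter_upwards [eventually_cell_eq_iff hf (y (t i)) (y (t j))] with N hN
    rw [hN]
    exact ⟨hy _ _ (ht i (mem_univ i)) (ht j (mem_univ j)), congrArg y⟩
  filter_upwards [separated] with N hN
  rw [tiePartition_congr hN]

end TiePartitionMeasure

section Mixture

open Filter Finset
open scoped Topology

lemma exp_mul_pow_div_mul_prod_div {T : ℝ} (hT : 0 ≤ T) {n : ℕ} {y : Fin n → ℝ}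
    (hy : T = 0 → ∀ i, y i = 0) :
    Real.exp (-T) * T ^ n / (n.factorial : ℝ) * ∏ i, (y i / T) =
      Real.exp (-T) / (n.factorial : ℝ) * ∏ i, y i := by
  rcases hT.eq_or_lt with rfl | hT
  · rcases Nat.eq_zero_or_pos n with rfl | hn
    · simp
    · rw [prod_eq_zero (mem_univ ⟨0, hn⟩) (hy rfl _)]
      simp [hn.ne']
  · rw [prod_div_distrib, prod_const, card_univ, Fintype.card_fin]
    field_simp

lemma ofReal_exp_neg_div_factorial_mul_pow_le_one {t : ℝ≥0∞} (ht : t ≠ ∞) (n : ℕ) :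
    ENNReal.ofReal (Real.exp (-t.toReal) / n.factorial) * t ^ n ≤ 1 := by
  rw [← ENNReal.ofReal_toReal (ENNReal.pow_ne_top ht), ← ENNReal.ofReal_mul (by positivity),
    ENNReal.toReal_pow]
  refine ENNReal.ofReal_le_one.2 ?_
  calc Real.exp (-t.toReal) / n.factorial * t.toReal ^ n
      = Real.exp (-t.toReal) * (t.toReal ^ n / n.factorial) := by ring
    _ ≤ Real.exp (-t.toReal) * Real.exp t.toReal := by
        gcongr
        exact Real.pow_div_factorial_le_exp _ ENNReal.toReal_nonneg n
    _ = 1 := by rw [← Real.exp_add, neg_add_cancel, Real.exp_zero]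

/-- The measure `∑ₖ vₖ δₖ` on the indices of the atoms. -/
noncomputable def weightMeasure (v : ℕ → ℝ≥0) : Measure ℕ :=
  Measure.sum fun k => (v k : ℝ≥0∞) • Measure.dirac k

lemma weightMeasure_singleton (v : ℕ → ℝ≥0) (k : ℕ) : weightMeasure v {k} = v k := by
  rw [weightMeasure, Measure.sum_smul_dirac_singleton]

lemma pi_weightMeasure_apply (v : ℕ → ℝ≥0) [IsFiniteMeasure (weightMeasure v)] {n : ℕ}
    (K : Set (Fin n → ℕ)) : Measure.pi (fun _ : Fin n => weightMeasure v) K =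
      ∑' k, K.indicator (fun k => ∏ i, (v (k i) : ℝ≥0∞)) k := by
  rw [← Measure.tsum_indicator_apply_singleton _ K .of_discrete]
  simp only [Measure.pi_singleton, weightMeasure_singleton]

variable {Ω S : Type*} [MeasurableSpace S] {w : ℕ → Ω → ℝ≥0} {x : ℕ → Ω → S}

lemma atomicMeasure_apply (ω : Ω) {A : Set S} (hA : MeasurableSet A) :
    atomicMeasure w x ω A = weightMeasure (fun k => w k ω) ((fun k => x k ω) ⁻¹' A) := by
  rw [atomicMeasure, weightMeasure, Measure.sum_apply _ hA, Measure.sum_apply _ .of_discrete]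
  refine tsum_congr fun k => ?_
  rw [Measure.smul_apply, Measure.smul_apply, Measure.dirac_apply' _ hA,
    Measure.dirac_apply' _ .of_discrete]
  rfl

lemma atomicMeasure_univ (ω : Ω) :
    atomicMeasure w x ω Set.univ = weightMeasure (fun k => w k ω) Set.univ := by
  rw [atomicMeasure_apply ω MeasurableSet.univ, Set.preimage_univ]

lemma isFiniteMeasure_weightMeasure {ω : Ω} (hω : atomicMeasure w x ω Set.univ < ∞) :
    IsFiniteMeasure (weightMeasure fun k => w k ω) :=
  ⟨by rwa [atomicMeasure_univ] at hω⟩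

lemma pi_weightMeasure_univ {ω : Ω} (hω : atomicMeasure w x ω Set.univ < ∞) (n : ℕ) :
    Measure.pi (fun _ : Fin n => weightMeasure fun k => w k ω) Set.univ =
      atomicMeasure w x ω Set.univ ^ n := by
  have := isFiniteMeasure_weightMeasure hω
  rw [Measure.pi_univ, prod_const, card_univ, Fintype.card_fin, atomicMeasure_univ]

lemma pi_weightMeasure_cell {ω : Ω} (hω : atomicMeasure w x ω Set.univ < ∞)
    {f : S → ℕ → Bool} (hf : Measurable f) (N : ℕ) {n : ℕ}
    (π : Finpartition (univ : Finset (Fin n))) :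
    Measure.pi (fun _ : Fin n => weightMeasure fun k => w k ω)
        {k | tiePartition (fun i => cell f N (x (k i) ω)) = π} =
      ∑ κ : Fin n → Fin N → Bool with tiePartition κ = π,
        ∏ i, atomicMeasure w x ω (cell f N ⁻¹' {κ i}) := by
  have := isFiniteMeasure_weightMeasure hω
  rw [pi_tiePartition_comp_eq_sum _ π (h := fun k => cell f N (x k ω)) .of_discrete]
  refine sum_congr rfl fun κ _ => prod_congr rfl fun i _ => ?_
  rw [atomicMeasure_apply ω (measurable_cell hf N (measurableSet_singleton _))]
  rfl

variable [MeasurableSpace Ω] {P : Measure Ω} {m : Ω → ℕ} {z : ℕ → Ω → ℕ}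

namespace IsCountMixture

lemma measurableSet (hmodel : IsCountMixture P w x m z) (n : ℕ)
    (K : Set (Fin n → ℕ)) : MeasurableSet {ω | m ω = n ∧ (fun i : Fin n => z i ω) ∈ K} :=
  (hmodel.measurable_size (measurableSet_singleton n)).inter
    ((measurable_pi_lambda _ fun i : Fin n => hmodel.measurable_index i)
      (MeasurableSet.of_discrete (s := K)))

lemma measurableSet_clusterEvent (hmodel : IsCountMixture P w x m z) {n : ℕ}
    (π : Finpartition (univ : Finset (Fin n))) : MeasurableSet (clusterEvent m z π) :=
  hmodel.measurableSet n {k | tiePartition k = π}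

lemma atomSigma_le (hmodel : IsCountMixture P w x m z) :
    atomSigma w x ≤ ‹MeasurableSpace Ω› :=
  iSup_le fun k => sup_le (hmodel.measurable_weight k).comap_le (hmodel.measurable_loc k).comap_le

lemma measure_singleton [IsProbabilityMeasure P] (hmodel : IsCountMixture P w x m z)
    (hfin : ∀ᵐ ω ∂P, atomicMeasure w x ω Set.univ < ∞) (n : ℕ) (k : Fin n → ℕ) :
    P {ω | m ω = n ∧ ∀ i : Fin n, z i ω = k i} =
      ∫⁻ ω, ENNReal.ofReal (Real.exp (-(atomicMeasure w x ω).real Set.univ) / n.factorial) *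
        ∏ i, (w (k i) ω : ℝ≥0∞) ∂P := by
  set E : Set Ω := {ω | m ω = n ∧ ∀ i : Fin n, z i ω = k i}
  have measurableSet_E : MeasurableSet E := by
    simpa only [Set.mem_singleton_iff, funext_iff] using hmodel.measurableSet n {k}
  have integral_eq := integral_condExp (μ := P) (f := E.indicator fun _ => (1 : ℝ))
    hmodel.atomSigma_le
  rw [integral_congr_ae (hmodel.condLaw n k), integral_indicator_const _ measurableSet_E,
    smul_eq_mul, mul_one] at integral_eq
  have integrable := (integrable_condExp (μ := P) (m := atomSigma w x)
    (f := E.indicator fun _ => (1 : ℝ))).congr (hmodel.condLaw n k)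
  rw [← ofReal_measureReal, ← integral_eq, ofReal_integral_eq_lintegral_ofReal integrable
    (.of_forall fun ω => by positivity)]
  refine lintegral_congr_ae ?_
  filter_upwards [hfin] with ω hω
  have : IsFiniteMeasure (atomicMeasure w x ω) := ⟨hω⟩
  have weight_eq_zero (h0 : (atomicMeasure w x ω).real Set.univ = 0) (i : Fin n) :
      (w (k i) ω : ℝ) = 0 := by
    rw [measureReal_eq_zero_iff, atomicMeasure_univ] at h0
    have singleton_eq_zero := measure_mono_null (Set.subset_univ {k i}) h0
    rw [weightMeasure_singleton] at singleton_eq_zero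
    exact_mod_cast singleton_eq_zero
  rw [exp_mul_pow_div_mul_prod_div measureReal_nonneg weight_eq_zero,
    ENNReal.ofReal_mul (by positivity),
    ENNReal.ofReal_prod_of_nonneg fun i _ => NNReal.coe_nonneg _]
  simp only [ENNReal.ofReal_coe_nnreal]

lemma measure_eq_lintegral [IsProbabilityMeasure P] (hmodel : IsCountMixture P w x m z)
    (hG : Measurable (atomicMeasure w x)) (hfin : ∀ᵐ ω ∂P, atomicMeasure w x ω Set.univ < ∞)
    (n : ℕ) (K : Set (Fin n → ℕ)) :
    P {ω | m ω = n ∧ (fun i : Fin n => z i ω) ∈ K} =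
      ∫⁻ ω, ENNReal.ofReal (Real.exp (-(atomicMeasure w x ω).real Set.univ) / n.factorial) *
        Measure.pi (fun _ : Fin n => weightMeasure fun k => w k ω) K ∂P := by
  have setOf_eq : {ω | m ω = n ∧ (fun i : Fin n => z i ω) ∈ K} =
      ⋃ k ∈ K, {ω | m ω = n ∧ ∀ i : Fin n, z i ω = k i} := by
    ext ω
    simp [← funext_iff (f := fun i : Fin n => z i ω)]
  have measurable_total : Measurable fun ω => (atomicMeasure w x ω).real Set.univ :=
    ((Measure.measurable_coe MeasurableSet.univ).comp hG).ennreal_toReal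
  have measurable_weights (k : Fin n → ℕ) : Measurable fun ω => ∏ i, (w (k i) ω : ℝ≥0∞) :=
    Finset.measurable_prod _ fun i _ => (hmodel.measurable_weight (k i)).coe_nnreal_ennreal
  rw [setOf_eq, measure_biUnion (Set.to_countable K)]
  · simp only [hmodel.measure_singleton hfin]
    rw [← lintegral_tsum fun k => by fun_prop]
    refine lintegral_congr_ae ?_
    filter_upwards [hfin] with ω hω
    have := isFiniteMeasure_weightMeasure hω
    rw [ENNReal.tsum_mul_left, pi_weightMeasure_apply,
      tsum_subtype K fun k => ∏ i, (w (k i) ω : ℝ≥0∞)]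
  · intro k _ k' _ hne
    exact Set.disjoint_left.2 fun ω hω hω' =>
      hne (funext fun i => (hω.2 i).symm.trans (hω'.2 i))
  · intro k _
    simpa only [Set.mem_singleton_iff, funext_iff] using hmodel.measurableSet n {k}

lemma measure_size_eq_lintegral [IsProbabilityMeasure P] (hmodel : IsCountMixture P w x m z)
    (hG : Measurable (atomicMeasure w x)) (hfin : ∀ᵐ ω ∂P, atomicMeasure w x ω Set.univ < ∞)
    (n : ℕ) :
    P {ω | m ω = n} = ∫⁻ ω, ENNReal.ofReal (Real.exp (-(atomicMeasure w x ω).real Set.univ) *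
        (atomicMeasure w x ω).real Set.univ ^ n / n.factorial) ∂P := by
  have measure_eq := hmodel.measure_eq_lintegral hG hfin n Set.univ
  simp only [Set.mem_univ, and_true] at measure_eq
  rw [measure_eq]
  refine lintegral_congr_ae ?_
  filter_upwards [hfin] with ω hω
  rw [pi_weightMeasure_univ hω, mul_div_right_comm, ENNReal.ofReal_mul (by positivity),
    ENNReal.ofReal_pow measureReal_nonneg, ofReal_measureReal hω.ne]

/-- Almost surely the cells eventually separate the sampled atoms, so ties of cells become ties of
atoms. -/
lemma tendsto_lintegral_cell [IsProbabilityMeasure P] (hmodel : IsCountMixture P w x m z)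
    (hG : Measurable (atomicMeasure w x)) (hfin : ∀ᵐ ω ∂P, atomicMeasure w x ω Set.univ < ∞)
    {f : S → ℕ → Bool} (hf : Measurable f) (hf_inj : Function.Injective f) {n : ℕ}
    (π : Finpartition (univ : Finset (Fin n))) :
    Tendsto (fun N => ∫⁻ ω,
      ENNReal.ofReal (Real.exp (-(atomicMeasure w x ω).real Set.univ) / n.factorial) *
        ∑ κ : Fin n → Fin N → Bool with tiePartition κ = π,
          ∏ i, atomicMeasure w x ω (cell f N ⁻¹' {κ i}) ∂P) atTop
      (𝓝 (P (clusterEvent m z π))) := by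
  have measurable_apply {A : Set S} (hA : MeasurableSet A) :
      Measurable fun ω => atomicMeasure w x ω A := (Measure.measurable_coe hA).comp hG
  have measurable_total := (measurable_apply MeasurableSet.univ).ennreal_toReal
  change Tendsto _ _ (𝓝 (P {ω | m ω = n ∧ (fun i : Fin n => z i ω) ∈ {k | tiePartition k = π}}))
  rw [hmodel.measure_eq_lintegral hG hfin]
  refine tendsto_lintegral_of_dominated_convergence (fun _ => 1) (fun N => ?_) (fun N => ?_)
    (by simp) ?_
  · exact Measurable.mul (measurable_total.neg.exp.div_const _).ennreal_ofReal
      (measurable_sum _ fun κ _ => Finset.measurable_prod _ fun i _ =>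
        measurable_apply (measurable_cell hf N (measurableSet_singleton _)))
  · filter_upwards [hfin] with ω hω
    refine le_trans ?_ (ofReal_exp_neg_div_factorial_mul_pow_le_one hω.ne n)
    rw [← pi_weightMeasure_cell hω hf N, ← pi_weightMeasure_univ hω, measureReal_def]
    gcongr
    exact Set.subset_univ _
  · filter_upwards [hfin, hmodel.distinct] with ω hω distinct
    have := isFiniteMeasure_weightMeasure hω
    simp only [← pi_weightMeasure_cell hω hf _]
    refine ENNReal.Tendsto.const_mul (tendsto_pi_tiePartition_cell _ π (y := fun k => x k ω)
      (fun j k hj hk => distinct j k ?_ ?_) hf_inj) (.inr ENNReal.ofReal_ne_top)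
    · rwa [weightMeasure_singleton, ENNReal.coe_ne_zero] at hj
    · rwa [weightMeasure_singleton, ENNReal.coe_ne_zero] at hk

variable [MeasurableSpace.CountablySeparated S] [IsProbabilityMeasure P] {G₀ : Measure S}
  [IsFiniteMeasure G₀] [NullSingletonClass G₀] {a p : ℝ}

lemma measureReal_clusterEvent_eq_prod_clusterWeight (hmodel : IsCountMixture P w x m z)
    (hG : IsGenGammaProcess P (atomicMeasure w x) G₀ a ((1 - p) / p)) (ha : a < 1)
    (hp0 : 0 < p) (hp1 : p < 1) {n : ℕ} (π : Finpartition (univ : Finset (Fin n))) :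
    P.real (clusterEvent m z π) = 1 / (n.factorial : ℝ) *
      (Real.exp (-(G₀.real Set.univ * clusterRate a p)) *
        ∏ B ∈ π.parts, G₀.real Set.univ * clusterWeight a p #B) := by
  obtain ⟨f, hf, hf_inj⟩ := MeasurableSpace.measurable_injection_nat_bool_of_countablySeparated S
  have tendsto_clusterEvent := hmodel.tendsto_lintegral_cell hG.measurable hG.finite hf hf_inj π
  have ofReal_exp_div (t : ℝ) : ENNReal.ofReal (Real.exp t / n.factorial) =
      ENNReal.ofReal (1 / n.factorial) * ENNReal.ofReal (Real.exp t) := by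
    rw [← ENNReal.ofReal_mul (by positivity), one_div_mul_eq_div]
  simp only [ofReal_exp_div, mul_assoc,
    lintegral_const_mul' _ _ ENNReal.ofReal_ne_top] at tendsto_clusterEvent
  have measure_eq := tendsto_nhds_unique tendsto_clusterEvent <|
    ENNReal.Tendsto.const_mul (hG.tendsto_lintegral_cell ha hp0 hp1 hf hf_inj π)
      (.inr ENNReal.ofReal_ne_top)
  have prod_nonneg : 0 ≤ ∏ B ∈ π.parts, G₀.real Set.univ * clusterWeight a p #B :=
    prod_nonneg fun B hB => mul_nonneg measureReal_nonneg
      (clusterWeight_pos ha hp0 (card_pos.2 (π.nonempty_of_mem_parts hB))).le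
  rw [measureReal_def, measure_eq, ← ENNReal.ofReal_mul (by positivity),
    prod_coe_sort π.parts fun B => G₀.real Set.univ * clusterWeight a p #B,
    ENNReal.toReal_ofReal (by positivity)]

lemma measureReal_clusterEvent (hmodel : IsCountMixture P w x m z)
    (hG : IsGenGammaProcess P (atomicMeasure w x) G₀ a ((1 - p) / p)) (ha : a < 1)
    (hp0 : 0 < p) (hp1 : p < 1) {n : ℕ} (π : Finpartition (univ : Finset (Fin n))) :
    P.real (clusterEvent m z π) =
      1 / (n.factorial : ℝ) * Real.exp (-(G₀.real Set.univ * clusterRate a p)) *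
        G₀.real Set.univ ^ #π.parts * p ^ ((n : ℝ) - a * #π.parts) *
        ∏ B ∈ π.parts, blockWeight a #B := by
  rw [hmodel.measureReal_clusterEvent_eq_prod_clusterWeight hG ha hp0 hp1]
  simp only [clusterWeight]
  rw [prod_mul_distrib, prod_mul_distrib, prod_const, ← Real.rpow_sum_of_pos hp0, sum_sub_distrib,
    ← Nat.cast_sum, π.sum_card_parts, sum_const, nsmul_eq_mul, card_univ, Fintype.card_fin,
    mul_comm a]
  ring

end IsCountMixture

end Mixture

/-! ### Sample size and cluster sizes -/

section Sizes

open Filter Finset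

section ClusterSizes

variable {Ω : Type*} (m : Ω → ℕ) (z : ℕ → Ω → ℕ)

lemma clusterSizes_of_size_eq {n : ℕ} {ω : Ω} (h : m ω = n) :
    clusterSizes m z ω = (tiePartition fun i : Fin n => z i ω).parts.val.map card := by
  subst h
  rfl

lemma sum_clusterSizes (ω : Ω) : (clusterSizes m z ω).sum = m ω :=
  (tiePartition fun i : Fin (m ω) => z i ω).sum_card_parts.trans (by simp)

lemma card_clusterSizes (ω : Ω) : (clusterSizes m z ω).card = numClusters m z ω :=
  Multiset.card_map _ _

lemma clusterSizes_preimage_singleton (M : Multiset ℕ) :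
    clusterSizes m z ⁻¹' {M} =
      ⋃ π ∈ univ.filter fun π : Finpartition (univ : Finset (Fin M.sum)) =>
        π.parts.val.map card = M, clusterEvent m z π := by
  ext ω
  simp only [Set.mem_preimage, Set.mem_singleton_iff, mem_filter_univ, Set.mem_iUnion,
    clusterEvent, Set.mem_ofPred_eq, exists_prop]
  constructor
  · intro sizes_eq
    have size_eq : m ω = M.sum := by rw [← sizes_eq, sum_clusterSizes]
    exact ⟨_, (clusterSizes_of_size_eq m z size_eq).symm.trans sizes_eq, size_eq, rfl⟩
  · rintro ⟨_, parts_eq, size_eq, rfl⟩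
    rw [clusterSizes_of_size_eq m z size_eq, parts_eq]

end ClusterSizes

variable {Ω S : Type*} [MeasurableSpace Ω] [MeasurableSpace S] {P : Measure Ω}
  {w : ℕ → Ω → ℝ≥0} {x : ℕ → Ω → S} {m : Ω → ℕ} {z : ℕ → Ω → ℕ}

namespace IsCountMixture

lemma measurable_clusterSizes (hmodel : IsCountMixture P w x m z) :
    Measurable (clusterSizes m z) := by
  refine measurable_to_countable' fun M => ?_
  rw [clusterSizes_preimage_singleton]
  exact Finset.measurableSet_biUnion _ fun π _ => hmodel.measurableSet_clusterEvent π

/-- Numbering the clusters in all `l!` ways turns each partition with these sizes into labellings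
whose label counts form the same multiset. -/
lemma measureReal_clusterSizes_preimage_singleton [IsFiniteMeasure P]
    (hmodel : IsCountMixture P w x m z) (M : Multiset ℕ) :
    P.real (clusterSizes m z ⁻¹' {M}) =
      ∑ u ∈ (univ : Finset (Fin M.card)).piAntidiag M.sum with
        (∀ k, 0 < u k) ∧ univ.val.map u = M, sizesProb P m z M.sum M.card u := by
  have card_parts {π : Finpartition (univ : Finset (Fin M.sum))}
      (hπ : π.parts.val.map card = M) : #π.parts = M.card := by
    simpa using congrArg Multiset.card hπ
  have labelled := factorial_smul_sum_card_parts_eq (n := M.sum) (l := M.card) fun π =>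
    if π.parts.val.map card = M then P.real (clusterEvent m z π) else 0
  rw [← sum_filter, filter_filter,
    filter_congr fun π _ => and_iff_right_of_imp (card_parts (π := π)), nsmul_eq_mul] at labelled
  rw [clusterSizes_preimage_singleton, measureReal_biUnion_finset]
  · refine mul_left_cancel₀ (a := (M.card.factorial : ℝ)) (by positivity) ?_
    rw [labelled, ← filter_filter, sum_filter fun u => univ.val.map u = M, mul_sum]
    refine sum_congr rfl fun u hu => ?_
    rw [sum_congr rfl fun c hc => by rw [map_card_parts_of_mem_labellings (mem_filter.1 hu).2 hc]]
    split_ifs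
    · rw [sizesProb, one_div, mul_inv_cancel_left₀ (by positivity)]
    · rw [sum_const_zero, mul_zero]
  · intro π _ π' _ hne
    exact Set.disjoint_left.2 fun ω hω hω' => hne (hω.2.symm.trans hω'.2)
  · exact fun π _ => hmodel.measurableSet_clusterEvent π

variable {G₀ : Measure S} {a p : ℝ}

lemma measureReal_size [IsProbabilityMeasure P] (hmodel : IsCountMixture P w x m z)
    (hG : IsGenGammaProcess P (atomicMeasure w x) G₀ a ((1 - p) / p)) (ha : a < 1)
    (hp0 : 0 < p) (hp1 : p < 1) (n : ℕ) :
    P.real {ω | m ω = n} = p ^ n / (n.factorial : ℝ) *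
      Real.exp (-(G₀.real Set.univ * clusterRate a p)) *
        eppfNormalizer (G₀.real Set.univ) a p n := by
  have ofReal_div (ω : Ω) : ENNReal.ofReal (Real.exp (-(atomicMeasure w x ω).real Set.univ) *
        (atomicMeasure w x ω).real Set.univ ^ n / n.factorial) =
      ENNReal.ofReal (1 / n.factorial) * ENNReal.ofReal
        ((atomicMeasure w x ω).real Set.univ ^ n *
          Real.exp (-(atomicMeasure w x ω).real Set.univ)) := by
    rw [← ENNReal.ofReal_mul (by positivity)]
    ring_nf
  have normalizer_nonneg := eppfNormalizer_nonneg ha hp0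
    (measureReal_nonneg : 0 ≤ G₀.real Set.univ) n
  rw [measureReal_def, hmodel.measure_size_eq_lintegral hG.measurable hG.finite,
    lintegral_congr ofReal_div, lintegral_const_mul' _ _ ENNReal.ofReal_ne_top,
    hG.lintegral_pow_mul_exp_neg ha hp0 hp1 MeasurableSet.univ,
    ← ENNReal.ofReal_mul (by positivity), ENNReal.toReal_ofReal (by positivity)]
  ring

variable [MeasurableSpace.CountablySeparated S] [IsProbabilityMeasure P] [IsFiniteMeasure G₀]
  [NullSingletonClass G₀]

lemma measureReal_cond_size_clusterEvent (hmodel : IsCountMixture P w x m z)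
    (hG : IsGenGammaProcess P (atomicMeasure w x) G₀ a ((1 - p) / p)) (ha : a < 1)
    (hp0 : 0 < p) (hp1 : p < 1) {n : ℕ} (π : Finpartition (univ : Finset (Fin n))) :
    (P[|{ω | m ω = n}]).real (clusterEvent m z π) =
      G₀.real Set.univ ^ #π.parts * p ^ (-(a * #π.parts)) /
          eppfNormalizer (G₀.real Set.univ) a p n *
        ∏ B ∈ π.parts, blockWeight a #B := by
  rw [measureReal_def, cond_apply (s := {ω | m ω = n})
      (hmodel.measurable_size (measurableSet_singleton n)),
    ENNReal.toReal_mul, ENNReal.toReal_inv, ← measureReal_def, ← measureReal_def,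
    Set.inter_eq_right.2 fun ω hω => hω.1, hmodel.measureReal_size hG ha hp0 hp1,
    hmodel.measureReal_clusterEvent hG ha hp0 hp1, sub_eq_add_neg, Real.rpow_add hp0,
    Real.rpow_natCast]
  have exp_ne_zero := (Real.exp_pos (-(G₀.real Set.univ * clusterRate a p))).ne'
  field_simp

lemma measureReal_clusterEvent_tiePartition (hmodel : IsCountMixture P w x m z)
    (hG : IsGenGammaProcess P (atomicMeasure w x) G₀ a ((1 - p) / p)) (ha : a < 1)
    (hp0 : 0 < p) (hp1 : p < 1) {n l : ℕ} {u : Fin l → ℕ} (hu : ∀ k, 0 < u k)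
    {c : Fin n → Fin l} (hc : c ∈ labellings n l u) :
    P.real (clusterEvent m z (tiePartition c)) = 1 / (n.factorial : ℝ) *
      (Real.exp (-(G₀.real Set.univ * clusterRate a p)) *
        ∏ k, G₀.real Set.univ * clusterWeight a p (u k)) := by
  have prod_eq := congrArg (fun s => (s.map fun k => G₀.real Set.univ * clusterWeight a p k).prod)
    (map_card_parts_of_mem_labellings hu hc)
  simp only [Multiset.map_map] at prod_eq
  rw [hmodel.measureReal_clusterEvent_eq_prod_clusterWeight hG ha hp0 hp1]
  exact congrArg (fun t => _ * (_ * t)) prod_eq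

lemma sizesProb_eq_mul_clusterEvent (hmodel : IsCountMixture P w x m z)
    (hG : IsGenGammaProcess P (atomicMeasure w x) G₀ a ((1 - p) / p)) (ha : a < 1)
    (hp0 : 0 < p) (hp1 : p < 1) {n l : ℕ} {u : Fin l → ℕ} (hu : ∀ k, 0 < u k)
    {c : Fin n → Fin l} (hc : c ∈ labellings n l u) :
    sizesProb P m z n l u =
      1 / (l.factorial : ℝ) * ((n.factorial : ℝ) / ∏ k, ((u k).factorial : ℝ)) *
        P.real (clusterEvent m z (tiePartition c)) := by
  have constant (c') (hc' : c' ∈ labellings n l u) :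
      P.real (clusterEvent m z (tiePartition c')) = P.real (clusterEvent m z (tiePartition c)) := by
    rw [hmodel.measureReal_clusterEvent_tiePartition hG ha hp0 hp1 hu hc,
      hmodel.measureReal_clusterEvent_tiePartition hG ha hp0 hp1 hu hc']
  rw [sizesProb, sum_congr rfl constant, sum_const, nsmul_eq_mul,
    cast_card_labellings (sum_eq_of_mem_labellings hc), mul_assoc]

lemma sizesProb_eq (hmodel : IsCountMixture P w x m z)
    (hG : IsGenGammaProcess P (atomicMeasure w x) G₀ a ((1 - p) / p)) (ha : a < 1)
    (hp0 : 0 < p) (hp1 : p < 1) {n l : ℕ} {u : Fin l → ℕ} (hu : ∀ k, 0 < u k) :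
    sizesProb P m z n l u =
      if ∑ k, u k = n then
        (poissonMeasure (G₀.real Set.univ * clusterRate a p).toNNReal).real {l} *
          ∏ k, tnbPMFReal a p (u k)
      else 0 := by
  split_ifs with sum_u
  · obtain ⟨c, hc⟩ : (labellings n l u).Nonempty := by
      rw [← card_pos, card_labellings sum_u]
      exact Nat.multinomial_pos _ _
    have rate_pos := clusterRate_pos ha hp0 hp1
    have factorial_ne_zero : ∏ k, ((u k).factorial : ℝ) ≠ 0 :=
      prod_ne_zero_iff.2 fun k _ => by positivity
    rw [hmodel.sizesProb_eq_mul_clusterEvent hG ha hp0 hp1 hu hc,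
      hmodel.measureReal_clusterEvent_tiePartition hG ha hp0 hp1 hu hc,
      poissonMeasure_real_singleton,
      Real.coe_toNNReal _ (mul_nonneg measureReal_nonneg rate_pos.le)]
    simp only [fun k => tnbPMFReal_eq_clusterWeight_div ha hp0 hp1 (hu k), prod_div_distrib,
      prod_mul_distrib, prod_const, card_univ, Fintype.card_fin, mul_pow]
    field_simp
  · rw [sizesProb, sum_eq_zero fun c hc => absurd (sum_eq_of_mem_labellings hc) sum_u, mul_zero]

end IsCountMixture

end Sizes

/-! ### Laws of the cluster sizes and of the sample size -/

section Laws

open Finset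

instance instDiscreteMeasurableSpaceMultisetNat : DiscreteMeasurableSpace (Multiset ℕ) :=
  ⟨fun _ => trivial⟩

lemma compoundSizesLaw_apply (r : ℝ≥0) (τ : Measure ℕ) (A : Set (Multiset ℕ)) :
    compoundSizesLaw r τ A = ∑' l : ℕ, poissonMeasure r {l} *
      (Measure.pi fun _ : Fin l => τ) {u | (univ : Finset (Fin l)).val.map u ∈ A} := by
  rw [compoundSizesLaw, Measure.bind_apply .of_discrete Measurable.of_discrete.aemeasurable,
    lintegral_countable']
  refine tsum_congr fun l => ?_
  rw [Measure.map_apply .of_discrete .of_discrete, mul_comm]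
  rfl

lemma compoundSizesLaw_singleton (r : ℝ≥0) (τ : Measure ℕ) [SigmaFinite τ] (M : Multiset ℕ) :
    compoundSizesLaw r τ {M} = poissonMeasure r {M.card} *
      ∑ u ∈ (univ : Finset (Fin M.card)).piAntidiag M.sum with univ.val.map u = M,
        ∏ k, τ {u k} := by
  rw [compoundSizesLaw_apply, tsum_eq_single M.card]
  · simp only [← Measure.pi_singleton, sum_measure_singleton]
    congr 2
    ext u
    simp only [coe_filter, mem_piAntidiag, Set.mem_ofPred_eq, Set.mem_singleton_iff]
    exact ⟨fun map_eq => ⟨⟨congrArg Multiset.sum map_eq, fun k _ => mem_univ k⟩, map_eq⟩,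
      And.right⟩
  · intro l hl
    have no_tuple : {u : Fin l → ℕ | univ.val.map u ∈ ({M} : Set (Multiset ℕ))} = ∅ :=
      Set.eq_empty_of_forall_notMem fun u map_eq =>
        hl (by simpa using congrArg Multiset.card map_eq)
    rw [no_tuple, measure_empty, mul_zero]

lemma compoundSizesLaw_map_card (r : ℝ≥0) (τ : Measure ℕ) [IsProbabilityMeasure τ] :
    (compoundSizesLaw r τ).map Multiset.card = poissonMeasure r := by
  refine Measure.ext_of_singleton fun l => ?_
  rw [Measure.map_apply .of_discrete .of_discrete, compoundSizesLaw_apply, tsum_eq_single l]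
  · simp
  · intro k hk
    simp [hk]

variable {a p : ℝ}

lemma compoundSizesLaw_tnbMeasure_singleton (ha : a < 1) (hp0 : 0 < p) (hp1 : p < 1) (r : ℝ≥0)
    (M : Multiset ℕ) :
    compoundSizesLaw r (tnbMeasure a p) {M} = ENNReal.ofReal
      (∑ u ∈ (univ : Finset (Fin M.card)).piAntidiag M.sum with
        (∀ k, 0 < u k) ∧ univ.val.map u = M,
          (poissonMeasure r).real {M.card} * ∏ k, tnbPMFReal a p (u k)) := by
  have := isProbabilityMeasure_tnbMeasure ha hp0 hp1
  have pmf_nonneg (u : Fin M.card → ℕ) (k : Fin M.card) : 0 ≤ tnbPMFReal a p (u k) :=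
    tnbPMFReal_nonneg ha hp0 hp1 _
  have prod_eq (u : Fin M.card → ℕ) :
      ∏ k, tnbMeasure a p {u k} = ENNReal.ofReal (∏ k, tnbPMFReal a p (u k)) := by
    simp only [tnbMeasure_singleton, ENNReal.ofReal_prod_of_nonneg fun k _ => pmf_nonneg u k]
  have prod_eq_zero_of_not_pos (u : Fin M.card → ℕ) (hu : ¬∀ k, 0 < u k) :
      ∏ k, tnbPMFReal a p (u k) = 0 := by
    obtain ⟨k, hk⟩ := not_forall.1 hu
    refine prod_eq_zero (mem_univ k) ?_
    rw [Nat.eq_zero_of_not_pos hk, tnbPMFReal_zero]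
  rw [compoundSizesLaw_singleton, ← mul_sum, ENNReal.ofReal_mul measureReal_nonneg,
    ofReal_measureReal,
    ENNReal.ofReal_sum_of_nonneg fun u _ => prod_nonneg fun k _ => pmf_nonneg u k]
  simp only [prod_eq]
  refine congrArg _ (sum_subset (monotone_filter_right _ fun _ _ => And.right)
    fun u hu not_mem => ?_).symm
  obtain ⟨u_mem, map_eq⟩ := mem_filter.1 hu
  rw [prod_eq_zero_of_not_pos u fun u_pos => not_mem (mem_filter.2 ⟨u_mem, u_pos, map_eq⟩),
    ENNReal.ofReal_zero]

variable {Ω S : Type*} [MeasurableSpace Ω] [MeasurableSpace S]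
  {P : Measure Ω} {w : ℕ → Ω → ℝ≥0} {x : ℕ → Ω → S} {m : Ω → ℕ} {z : ℕ → Ω → ℕ}

lemma measurable_poissonMeasure_toNNReal :
    Measurable fun t : ℝ => poissonMeasure t.toNNReal := by
  refine Measure.measurable_of_measurable_coe _ fun A _ => ?_
  simp only [← Measure.tsum_indicator_apply_singleton _ A .of_discrete,
    poissonMeasure_singleton]
  refine Measurable.tsum fun n => ?_
  by_cases hn : n ∈ A
  · simp only [Set.indicator_of_mem hn]
    fun_prop
  · simp only [Set.indicator_of_notMem hn, measurable_const]

namespace IsCountMixture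

variable [IsProbabilityMeasure P] {G₀ : Measure S}

lemma isGenNegBinomial_map_size (hmodel : IsCountMixture P w x m z)
    (hG : IsGenGammaProcess P (atomicMeasure w x) G₀ a ((1 - p) / p)) :
    IsGenNegBinomial (P.map m) (G₀.real Set.univ) a p := by
  have law_total := hG.law Set.univ MeasurableSet.univ
  rw [inv_div] at law_total
  refine ⟨_, law_total, Measure.ext_of_singleton fun n => ?_⟩
  rw [Measure.map_apply hmodel.measurable_size .of_discrete,
    Measure.bind_apply .of_discrete measurable_poissonMeasure_toNNReal.aemeasurable,
    lintegral_map _ (hG.measurable_real MeasurableSet.univ)]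
  · refine (hmodel.measure_size_eq_lintegral hG.measurable hG.finite n).trans
      (lintegral_congr fun ω => ?_)
    rw [poissonMeasure_singleton, Real.coe_toNNReal _ measureReal_nonneg]
  · exact (Measure.measurable_coe .of_discrete).comp measurable_poissonMeasure_toNNReal

variable [MeasurableSpace.CountablySeparated S] [IsFiniteMeasure G₀] [NullSingletonClass G₀]

lemma hasLaw_clusterSizes (hmodel : IsCountMixture P w x m z)
    (hG : IsGenGammaProcess P (atomicMeasure w x) G₀ a ((1 - p) / p)) (ha : a < 1)
    (hp0 : 0 < p) (hp1 : p < 1) :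
    HasLaw (clusterSizes m z)
      (compoundSizesLaw (G₀.real Set.univ * clusterRate a p).toNNReal (tnbMeasure a p)) P := by
  refine ⟨hmodel.measurable_clusterSizes.aemeasurable, Measure.ext_of_singleton fun M => ?_⟩
  rw [Measure.map_apply hmodel.measurable_clusterSizes .of_discrete, ← ofReal_measureReal,
    hmodel.measureReal_clusterSizes_preimage_singleton,
    compoundSizesLaw_tnbMeasure_singleton ha hp0 hp1]
  refine congrArg ENNReal.ofReal (sum_congr rfl fun u hu => ?_)
  obtain ⟨hu_mem, hu_pos, -⟩ := mem_filter.1 hu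
  rw [hmodel.sizesProb_eq hG ha hp0 hp1 hu_pos, if_pos (mem_piAntidiag.1 hu_mem).1]

lemma hasLaw_numClusters (hmodel : IsCountMixture P w x m z)
    (hG : IsGenGammaProcess P (atomicMeasure w x) G₀ a ((1 - p) / p)) (ha : a < 1)
    (hp0 : 0 < p) (hp1 : p < 1) :
    HasLaw (numClusters m z)
      (poissonMeasure (G₀.real Set.univ * clusterRate a p).toNNReal) P := by
  have := isProbabilityMeasure_tnbMeasure ha hp0 hp1
  rw [← funext (card_clusterSizes m z)]
  exact HasLaw.comp ⟨Measurable.of_discrete.aemeasurable, compoundSizesLaw_map_card _ _⟩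
    (hmodel.hasLaw_clusterSizes hG ha hp0 hp1)

end IsCountMixture

end Laws

/-! ### Probability generating functions -/

section GeneratingFunction

variable {a p γ t : ℝ}

lemma integral_pow_poissonMeasure (r : ℝ≥0) (t : ℝ) :
    ∫ n, t ^ n ∂poissonMeasure r = Real.exp (-((1 - t) * r)) := by
  have hasSum_exp : HasSum (fun n : ℕ => Real.exp (-r) * ((t * r) ^ n / n.factorial))
      (Real.exp (-r) * Real.exp (t * r)) := by
    rw [Real.exp_eq_exp_ℝ]
    exact (NormedSpace.expSeries_div_hasSum_exp (𝔸 := ℝ) (t * r)).mul_left _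
  rw [integral_poissonMeasure]
  calc ∑' n : ℕ, (Real.exp (-r) * r ^ n / n.factorial) • t ^ n
      = ∑' n : ℕ, Real.exp (-r) * ((t * r) ^ n / n.factorial) :=
        tsum_congr fun n => by rw [smul_eq_mul, mul_pow]; ring
    _ = Real.exp (-((1 - t) * r)) := by
        rw [hasSum_exp.tsum_eq, ← Real.exp_add]
        congr 1
        ring

lemma IsGenNegBinomial.integral_pow {μ : Measure ℕ} (hμ : IsGenNegBinomial μ γ a p)
    (hp0 : 0 < p) (hp1 : p < 1) (ht : |t| ≤ 1) :
    ∫ n, t ^ n ∂μ = Real.exp (-(γ * gnbExponent a p t)) := by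
  obtain ⟨ν, hν, rfl⟩ := hμ
  have t_le_one : t ≤ 1 := (abs_le.1 ht).2
  have := hν.isProbabilityMeasure
  let κ : Kernel ℝ ℕ := ⟨_, measurable_poissonMeasure_toNNReal⟩
  have : IsMarkovKernel κ := ⟨fun x => inferInstanceAs (IsProbabilityMeasure (poissonMeasure _))⟩
  have integrable_pow : Integrable (fun n : ℕ => t ^ n) (κ ∘ₘ ν) :=
    .of_bound .of_discrete 1 (.of_forall fun n => by
      rw [norm_pow]
      exact pow_le_one₀ (norm_nonneg t) ht)
  calc ∫ n, t ^ n ∂(κ ∘ₘ ν)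
      = ∫ x, Real.exp (-((1 - t) * x)) ∂ν := by
        rw [Measure.comp_eq_comp_const_apply] at integrable_pow ⊢
        rw [Kernel.integral_comp integrable_pow, Kernel.const_apply]
        refine integral_congr_ae (hν.nonneg.mono fun x hx => ?_)
        exact (integral_pow_poissonMeasure _ t).trans (by rw [Real.coe_toNNReal x hx])
    _ = Real.exp (-(γ * gnbExponent a p t)) := by
        rw [hν.laplace _ (sub_nonneg.2 t_le_one), inv_div,
          genGammaExponent_eq_gnbExponent a hp0 hp1 t_le_one]

end GeneratingFunction

theorem mainTheorem7 {Ω S : Type*} [MeasurableSpace Ω] [MeasurableSpace S]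
    [MeasurableSpace.CountablySeparated S]
    (P : Measure Ω) [IsProbabilityMeasure P]
    (G₀ : Measure S) [IsFiniteMeasure G₀] [NullSingletonClass G₀] (hG₀ : G₀ ≠ 0)
    (γ : ℝ) (hγ : γ = G₀.real Set.univ)
    (a p : ℝ) (ha : a < 1) (hp0 : 0 < p) (hp1 : p < 1)
    (w : ℕ → Ω → ℝ≥0) (x : ℕ → Ω → S) (m : Ω → ℕ) (z : ℕ → Ω → ℕ)
    (hG : IsGenGammaProcess P (atomicMeasure w x) G₀ a ((1 - p) / p))
    (hmodel : IsCountMixture P w x m z) :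
    -- exchangeable cluster probability function
    (∀ (n : ℕ) (π : Finpartition (Finset.univ : Finset (Fin n))),
      P.real (clusterEvent m z π) =
        1 / (n.factorial : ℝ) * Real.exp (-(γ * clusterRate a p)) *
          γ ^ π.parts.card * p ^ ((n : ℝ) - a * π.parts.card) *
          ∏ B ∈ π.parts, Real.Gamma ((B.card : ℝ) - a) / Real.Gamma (1 - a)) ∧
    -- exchangeable partition probability function
    (∀ (n : ℕ) (π : Finpartition (Finset.univ : Finset (Fin n))),
      (P[|{ω | m ω = n}]).real (clusterEvent m z π) =
        γ ^ π.parts.card * p ^ (-(a * π.parts.card)) / eppfNormalizer γ a p n *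
          ∏ B ∈ π.parts, Real.Gamma ((B.card : ℝ) - a) / Real.Gamma (1 - a)) ∧
    -- series form of its denominator, `Γ(n - ak) / Γ(-ak)` being the rising factorial of `-ak`
    (a ≠ 0 → ∀ n : ℕ, HasSum
      (fun k : ℕ => Real.exp (γ / (a * p ^ a)) *
        (1 / (k.factorial : ℝ) * (-(γ / (a * p ^ a))) ^ k *
          (ascPochhammer ℝ n).eval (-(a * k))))
      (eppfNormalizer γ a p n)) ∧
    -- probability of a collection of unordered cluster sizes
    (∀ (n l : ℕ) (u : Fin l → ℕ), (∀ k, 0 < u k) →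
      (∀ c ∈ labellings n l u,
        sizesProb P m z n l u =
          1 / (l.factorial : ℝ) * ((n.factorial : ℝ) / ∏ k, ((u k).factorial : ℝ)) *
            P.real (clusterEvent m z (tiePartition c))) ∧
      sizesProb P m z n l u =
        if ∑ k, u k = n then
          (poissonMeasure (γ * clusterRate a p).toNNReal).real {l} * ∏ k, tnbPMFReal a p (u k)
        else 0) ∧
    -- Poisson number of clusters with i.i.d. truncated negative binomial sizes
    IsProbabilityMeasure (tnbMeasure a p) ∧
    HasLaw (clusterSizes m z)
      (compoundSizesLaw (γ * clusterRate a p).toNNReal (tnbMeasure a p)) P ∧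
    HasLaw (numClusters m z) (poissonMeasure (γ * clusterRate a p).toNNReal) P ∧
    -- generalized negative binomial sample size
    IsGenNegBinomial (P.map m) γ a p ∧
    (∀ t : ℝ, |t| ≤ 1 → ∫ ω, t ^ m ω ∂P = Real.exp (-(γ * gnbExponent a p t))) ∧
    (∀ n : ℕ, P.real {ω | m ω = n} =
      p ^ n / (n.factorial : ℝ) * Real.exp (-(γ * clusterRate a p)) * eppfNormalizer γ a p n) := by
  subst hγ
  refine ⟨fun n => hmodel.measureReal_clusterEvent hG ha hp0 hp1,
    fun n => hmodel.measureReal_cond_size_clusterEvent hG ha hp0 hp1,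
    fun ha0 => hasSum_eppfNormalizer ha ha0 hp0 _,
    fun n l u hu => ⟨fun c => hmodel.sizesProb_eq_mul_clusterEvent hG ha hp0 hp1 hu,
      hmodel.sizesProb_eq hG ha hp0 hp1 hu⟩,
    isProbabilityMeasure_tnbMeasure ha hp0 hp1,
    hmodel.hasLaw_clusterSizes hG ha hp0 hp1,
    hmodel.hasLaw_numClusters hG ha hp0 hp1,
    hmodel.isGenNegBinomial_map_size hG, fun t ht => ?_,
    hmodel.measureReal_size hG ha hp0 hp1⟩
  rw [← (hmodel.isGenNegBinomial_map_size hG).integral_pow hp0 hp1 ht,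
    integral_map hmodel.measurable_size.aemeasurable .of_discrete]
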